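/- **Concurrent games with communication.** An arena consists of finite sets $V$ (vertices), $\mathsf{Act}$ (actions) and $\mathsf{Agt}\neq\emptyset$ (players), an initial vertex $v_0\in V$, nonempty sets $\mathsf{Allow}(v,a)\subseteq\mathsf{Act}$ of actions available to player $a$ in vertex $v$, and a map $\mathsf{Tab}\colon V\times\mathsf{Act}^{\mathsf{Agt}}\to V$. A concurrent game $\mathcal G$ is an arena with payoff functions $\mathsf{payoff}_a\colon V^\omega\to\overline{\mathbb R}$ ($a\in\mathsf{Agt}$). A communication graph is a directed graph $G=(\mathsf{Agt},E)$; write $a\to b$ if $(a,b)\in E$ or $a=b$, and $\mathrm{dist}_G(a,b)\in\mathbb N\cup\{\infty\}$ for the directed distance. A full history is a sequence $v_0(m_0,\mathsf{mes}_0)v_1\cdots(m_{s-1},\mathsf{mes}_{s-1})v_s$ with moves $m_r\in\mathsf{Act}^{\mathsf{Agt}}$, messages $\mathsf{mes}_r\in(\{0,1\}^*)^{\mathsf{Agt}}$, $m_r(a)\in\mathsf{Allow}(v_r,a)$ and $v_{r+1}=\mathsf{Tab}(v_r,m_r)$. A strategy of player $a$ maps each full history, with last vertex $v$, to an action in $\mathsf{Allow}(v,a)$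 and a message in $\{0,1\}^*$; it is $G$-compatible if it takes the same value on any two histories with the same vertices and the same actions and messages of all players $b\to a$. A Nash equilibrium is a profile of $G$-compatible strategies such that no player $d$ can strictly increase $\mathsf{payoff}_d$ of the vertex sequence of the outcome by unilaterally switching to another $G$-compatible strategy; its payoff is the vector of payoffs of the vertex sequence of its outcome. **The epistemic game $\mathcal E_{\mathcal G}^G$.** A situation is a triple $(d,I,K)$ with $d\in I\subseteq\mathsf{Agt}$ and $K\colon\mathsf{Agt}\to2^{\mathsf{Agt}}$ with $K(a)=\{d\}$ for all $a\in I$. Eve's states are pairs $(v,X)$ with $v\in V$ and $X$ a set of situations containing at most one situation $(d,I_d^X,K_d^X)$ for each $d$; $\mathsf{dev}(X)$ is the set of those $d$ for which there is one. The initial state is $(v_0,\emptyset)$. Say that $d$ can reach $v'$ from $(v,m)$ if $\mathsf{Tab}(v,m[d/\delta])=v'$ for some $\delta\in\mathsf{Allow}(v,d)$. * In $(v,\emptyset)$ Eve plays a move $m$ with $m(a)\in\mathsf{Allow}(v,a)$ for all $a$. Adam then chooses a vertex $v'$ that some player can reach from $(v,m)$. If $v'=\mathsf{Tab}(v,m)$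 (Adam complies), the next state is $(v',\emptyset)$. Otherwise it is $(v',X')$, where $\mathsf{dev}(X')$ is the set of players that can reach $v'$ from $(v,m)$, $I_d^{X'}=\{a\mid d\to a\}$, $K_d^{X'}(a)=\{d\}$ for $a\in I_d^{X'}$, and $K_d^{X'}(a)=\{b\mid b\text{ can reach }v'\text{ from }(v,m)\}\setminus\{b\mid b\to a\}$ for $a\notin I_d^{X'}$. * In $(v,X)$ with $X\ne\emptyset$ Eve plays $f\colon\mathsf{dev}(X)\to\mathsf{Act}^{\mathsf{Agt}}$ with $f(d)(a)\in\mathsf{Allow}(v,a)$ and such that $f(d)(a)=f(d')(a)$ whenever $a\notin I_d^X\cup I_{d'}^X$ and $K_d^X(a)=K_{d'}^X(a)$. Adam then chooses $v'$ such that some $d\in\mathsf{dev}(X)$ can reach $v'$ from $(v,f(d))$. The next state is $(v',X')$, where $\mathsf{dev}(X')$ is the set of those $d\in\mathsf{dev}(X)$ that can reach $v'$ from $(v,f(d))$, $I_d^{X'}=I_d^X\cup\{a\mid\exists b\in I_d^X,\ b\to a\}$, $K_d^{X'}(a)=\{d\}$ for $a\in I_d^{X'}$, and for $a\notin I_d^{X'}$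 $$K_d^{X'}(a)=\{b\in K_d^X(a)\mid b\text{ can reach }v'\text{ from }(v,f(b))\}\setminus\{c\mid\mathrm{dist}_G(c,a)\le\max_{c'\in I_c^X}\mathrm{dist}_G(c,c')+1\},$$ where $b$ and $c$ range over $\mathsf{dev}(X)$. For a play $R$ through the Eve states $(v_0,X_0),(v_1,X_1),\dots$, let $\mathsf{visited}(R)=v_0v_1\cdots$, and let $\mathsf{dev}(R)$ be the set of $d$ with $d\in\mathsf{dev}(X_n)$ for all large $n$. A strategy $\zeta$ of Eve (a map from histories to actions available to her) is winning for $p$ if $\mathsf{payoff}(\mathsf{visited}(R))=p$ for its unique outcome $R$ along which Adam always complies, and $\mathsf{payoff}_d(\mathsf{visited}(R'))\le p_d$ for every other outcome $R'$ of $\zeta$ and every $d\in\mathsf{dev}(R')$. **Theorem.** Let an arena and a communication graph $G$ be given. For all payoff functions (giving a game $\mathcal G$) and all $p\in\overline{\mathbb R}^{\mathsf{Agt}}$, there is a Nash equilibrium with payoff $p$ in $\mathcal G$ if and only if Eve has a winning strategy for payoff $p$ in $\mathcal E_{\mathcal G}^G$. Moreover the correspondence is constructive: there are effective maps $\Omega$,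 from strategies of Eve to strategy profiles, and $\Upsilon$, from strategy profiles to strategies of Eve, depending only on the arena and on $G$, such that for all payoff functions and all $p$, if $\zeta$ is winning for $p$ then $\Omega(\zeta)$ is a Nash equilibrium with payoff $p$, and if $\sigma$ is a Nash equilibrium with payoff $p$ then $\Upsilon(\sigma)$ is winning for $p$. Here effective means that a single algorithm computes every value of the new strategy (profile) from the history in question, with finitely many queries to the given strategy (profile) as an oracle. -/

import Mathlib

namespace CommGame

/-! ### Concurrent games with a communication graph -/

/-- The arena of a concurrent multiplayer game: everything but the payoff functions. -/
structure Arena (V Act Agt : Type*) where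
  /-- the initial vertex -/
  init : V
  /-- the actions available to a player in a vertex -/
  allow : V → Agt → Set Act
  allow_nonempty : ∀ v a, (allow v a).Nonempty
  /-- the target vertex of a move -/
  tab : V → (Agt → Act) → V

/-- A concurrent multiplayer game. Payoffs take extended real values. -/
structure ConcurrentGame (V Act Agt : Type*) extends Arena V Act Agt where
  payoff : Agt → (ℕ → V) → EReal

/-- `a → b`: either `(a, b)` is an edge of the communication graph, or `a = b`. -/
def Hears {Agt : Type*} (G : Digraph Agt) (a b : Agt) : Prop := G.Adj a b ∨ a = b

/-- There is a directed path with `n` edges from `a` to `b`. -/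
def PathOfLength {Agt : Type*} (G : Digraph Agt) : ℕ → Agt → Agt → Prop
  | 0, a, b => a = b
  | n + 1, a, b => ∃ c, PathOfLength G n a c ∧ G.Adj c b

/-- The distance from `a` to `b` in the communication graph (`⊤` if there is no path). -/
noncomputable def gdist {Agt : Type*} (G : Digraph Agt) (a b : Agt) : ℕ∞ :=
  ⨅ (n : ℕ) (_ : PathOfLength G n a b), (n : ℕ∞)

/-- A vector of messages, one word over `{0,1}` for every player. -/
abbrev Messages (Agt : Type*) := Agt → List Bool

/-- A sequence `v₀ · (m₀, mes₀) · v₁ ⋯ (mₛ₋₁, mesₛ₋₁) · vₛ` starting in the initial vertex `v₀`,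
stored as the list of its steps `(mᵢ, mesᵢ, vᵢ₊₁)`, the most recent step first. -/
abbrev FullHist (V Act Agt : Type*) := List ((Agt → Act) × Messages Agt × V)

/-- What each player does after each history: an action together with a message to broadcast.
Only the values on full histories of the game matter. -/
abbrev Profile (V Act Agt : Type*) := Agt → FullHist V Act Agt → Act × List Bool

namespace Arena

variable {V Act Agt : Type*} (A : Arena V Act Agt)

/-- The last vertex of a history. -/
def last : FullHist V Act Agt → V
  | [] => A.init
  | (_, _, v) :: _ => v

/-- The full histories of the arena from the initial vertex. -/
def IsHist : FullHist V Act Agt → Prop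
  | [] => True
  | (m, _, v) :: h => IsHist h ∧ (∀ a, m a ∈ A.allow (A.last h) a) ∧ v = A.tab (A.last h) m

end Arena

/-- The projection of a history for player `a`: the vertices, and the actions and messages of
the players in the neighbourhood of `a`. -/
def proj {V Act Agt : Type*} (G : Digraph Agt) (a : Agt) (h : FullHist V Act Agt) :
    List (({b // Hears G b a} → Act) × ({b // Hears G b a} → List Bool) × V) :=
  h.map fun s => (fun b => s.1 b, fun b => s.2.1 b, s.2.2)

namespace Arena

variable {V Act Agt : Type*} (A : Arena V Act Agt)

/-- `σ` is a strategy of player `a`. -/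
def IsStrategy (a : Agt) (σ : FullHist V Act Agt → Act × List Bool) : Prop :=
  ∀ h, A.IsHist h → (σ h).1 ∈ A.allow (A.last h) a

/-- The strategy `σ` of player `a` only depends on what player `a` observes. -/
def IsCompatible (G : Digraph Agt) (a : Agt) (σ : FullHist V Act Agt → Act × List Bool) : Prop :=
  ∀ h h', A.IsHist h → A.IsHist h' → proj G a h = proj G a h' → σ h = σ h'

/-- The prefix with `n` steps of the unique full play which is an outcome of all the strategies
of the profile. -/
def out (σ : Profile V Act Agt) : ℕ → FullHist V Act Agt
  | 0 => []
  | n + 1 =>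
    (fun a => (σ a (out σ n)).1, fun a => (σ a (out σ n)).2,
      A.tab (A.last (out σ n)) fun a => (σ a (out σ n)).1) :: out σ n

/-- The sequence of vertices visited by the outcome of the profile. -/
def outVertices (σ : Profile V Act Agt) (n : ℕ) : V := A.last (A.out σ n)

/-- By changing (or not) her own action in the move `m`, player `d` can, with one of her
available actions, make the game proceed from `v` to `v'`. -/
def CanReach [DecidableEq Agt] (v : V) (m : Agt → Act) (d : Agt) (v' : V) : Prop :=
  ∃ δ ∈ A.allow v d, A.tab v (Function.update m d δ) = v'

end Arena

/-- Nash equilibria from the initial vertex: profiles of `G`-compatible strategies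
without a profitable single-player deviation. -/
def ConcurrentGame.IsNash {V Act Agt : Type*} [DecidableEq Agt] (𝒢 : ConcurrentGame V Act Agt)
    (G : Digraph Agt) (σ : Profile V Act Agt) : Prop :=
  (∀ a, 𝒢.IsStrategy a (σ a) ∧ 𝒢.IsCompatible G a (σ a)) ∧
    ∀ d σ', 𝒢.IsStrategy d σ' → 𝒢.IsCompatible G d σ' →
      ¬ 𝒢.payoff d (𝒢.outVertices σ) < 𝒢.payoff d (𝒢.outVertices (Function.update σ d σ'))

/-- The outcome of the profile has payoff `p`. -/
def ConcurrentGame.HasPayoff {V Act Agt : Type*} (𝒢 : ConcurrentGame V Act Agt)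
    (σ : Profile V Act Agt) (p : Agt → EReal) : Prop :=
  ∀ a, 𝒢.payoff a (𝒢.outVertices σ) = p a

/-! ### Two-player turn-based game structures

Eve and Adam alternate, Eve moves first. -/

/-- A turn-based game structure with states `SE` of Eve and `SA` of Adam, and with actions
`AE` of Eve and `AA` of Adam. -/
structure TurnGame (SE SA AE AA : Type*) where
  init : SE
  allowE : SE → Set AE
  allowA : SA → Set AA
  tabE : SE → AE → SA
  tabA : SA → AA → SE
  nonblockingE : ∀ s, (allowE s).Nonempty
  nonblockingA : ∀ s, ∀ f ∈ allowE s, (allowA (tabE s f)).Nonempty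

/-- An infinite alternating sequence `eve 0 · adam 0 · eve 1 · adam 1 ⋯` of states. -/
@[ext] structure Play (SE SA : Type*) where
  eve : ℕ → SE
  adam : ℕ → SA

/-- The prefix of a play that ends in `eve n`, as a list (most recent first) of pairs
`(adam i, eve (i + 1))`; the first state is always the initial one and is not recorded. -/
def Play.hist {SE SA : Type*} (R : Play SE SA) : ℕ → List (SA × SE)
  | 0 => []
  | n + 1 => (R.adam n, R.eve (n + 1)) :: R.hist n

namespace TurnGame

variable {SE SA AE AA : Type*} (E : TurnGame SE SA AE AA)

/-- The last state of a history that ends in a state of Eve. -/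
def last : List (SA × SE) → SE
  | [] => E.init
  | (_, s) :: _ => s

/-- The histories from the initial state that end in a state of Eve. -/
def IsHist : List (SA × SE) → Prop
  | [] => True
  | (t, s) :: H => IsHist H ∧ (∃ f ∈ E.allowE (E.last H), t = E.tabE (E.last H) f) ∧
      ∃ α ∈ E.allowA t, s = E.tabA t α

/-- `ζ` is a strategy of Eve. Only its values on histories matter. -/
def IsEveStrategy (ζ : List (SA × SE) → AE) : Prop :=
  ∀ H, E.IsHist H → ζ H ∈ E.allowE (E.last H)

/-- `R` is an outcome from the initial state of the strategy `ζ` of Eve. -/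
def IsOutcome (ζ : List (SA × SE) → AE) (R : Play SE SA) : Prop :=
  R.eve 0 = E.init ∧ ∀ n, R.adam n = E.tabE (R.eve n) (ζ (R.hist n)) ∧
    ∃ α ∈ E.allowA (R.adam n), R.eve (n + 1) = E.tabA (R.adam n) α

end TurnGame

/-! ### The epistemic game -/

/-- A situation `(d, I, K)`: a deviator, the set of players who have received the information
that `d` is the deviator, and the set of suspects of every player. -/
@[ext] structure Situation (Agt : Type*) where
  dev : Agt
  I : Set Agt
  K : Agt → Set Agt
  dev_mem : dev ∈ I
  K_eq : ∀ a ∈ I, K a = {dev}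

/-- Eve's states: a vertex and a set of situations, at most one for each deviator. -/
@[ext] structure EveState (V Agt : Type*) where
  vtx : V
  sits : Set (Situation Agt)
  unique : ∀ s ∈ sits, ∀ t ∈ sits, s.dev = t.dev → s = t

/-- The set `dev(X)`. -/
def EveState.devs {V Agt : Type*} (s : EveState V Agt) : Set Agt :=
  {d | ∃ t ∈ s.sits, t.dev = d}

/-- Eve's actions: a move (used when there is no situation), or a partial function from players
to moves (used otherwise; its domain will be `dev(X)`). -/
inductive EveAction (Act Agt : Type*)
  | move (m : Agt → Act)
  | resp (f : Agt → Option (Agt → Act))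

/-- Adam's states: a state of Eve with the action that Eve has played there. -/
abbrev AdamState (V Act Agt : Type*) := EveState V Agt × EveAction Act Agt

/-- Histories of the epistemic game that end in a state of Eve. -/
abbrev EpiHist (V Act Agt : Type*) := List (AdamState V Act Agt × EveState V Agt)

namespace Arena

variable {V Act Agt : Type*} [DecidableEq Agt] (A : Arena V Act Agt) (G : Digraph Agt)

/-- The actions of Eve that are enabled in a state. -/
def epiAllowE (s : EveState V Agt) : Set (EveAction Act Agt)
  | .move m => s.sits = ∅ ∧ ∀ a, m a ∈ A.allow s.vtx a
  | .resp f => s.sits ≠ ∅ ∧ (∀ d, (f d).isSome ↔ d ∈ s.devs) ∧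
      (∀ d m, f d = some m → ∀ a, m a ∈ A.allow s.vtx a) ∧
      ∀ t ∈ s.sits, ∀ t' ∈ s.sits, ∀ a, a ∉ t.I ∪ t'.I → t.K a = t'.K a →
        ∀ m m', f t.dev = some m → f t'.dev = some m' → m a = m' a

/-- The vertices that Adam can choose. -/
def epiAllowA : AdamState V Act Agt → Set V
  | (s, .move m) => {v' | ∃ d, A.CanReach s.vtx m d v'}
  | (s, .resp f) => {v' | ∃ d ∈ s.devs, ∃ m, f d = some m ∧ A.CanReach s.vtx m d v'}

/-- `update((v, ∅), m, v')`. For players in `t.I` the value of `t.K` is prescribed by the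
definition of a situation. -/
def updateFirst (v : V) (m : Agt → Act) (v' : V) : Set (Situation Agt) :=
  {t | A.tab v m ≠ v' ∧ A.CanReach v m t.dev v' ∧
    t.I = {a | Hears G t.dev a} ∧
    ∀ a ∉ t.I, t.K a = {b | A.CanReach v m b v'} \ {b | Hears G b a}}

/-- `update((v, X), f, v')` for nonempty `X`. For players in `t.I` the value of `t.K` is
prescribed by the definition of a situation. -/
def updateNext (s : EveState V Agt) (f : Agt → Option (Agt → Act)) (v' : V) :
    Set (Situation Agt) :=
  {t | ∃ u ∈ s.sits, t.dev = u.dev ∧ (∃ m, f u.dev = some m ∧ A.CanReach s.vtx m u.dev v') ∧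
    t.I = u.I ∪ {a | ∃ b ∈ u.I, Hears G b a} ∧
    ∀ a ∉ t.I, t.K a =
      {b ∈ u.K a | ∃ m, f b = some m ∧ A.CanReach s.vtx m b v'} \
        {c | ∃ w ∈ s.sits, w.dev = c ∧ gdist G c a ≤ (⨆ c' ∈ w.I, gdist G c c') + 1}}

/-- The next state of Eve when Adam chooses the vertex `v'`. -/
def epiTabA : AdamState V Act Agt → V → EveState V Agt
  | (s, .move m), v' =>
    { vtx := v'
      sits := A.updateFirst G s.vtx m v'
      unique := by
        rintro t ⟨-, -, hI, hK⟩ t' ⟨-, -, hI', hK'⟩ hd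
        have hII : t.I = t'.I := by rw [hI, hI', hd]
        refine Situation.ext hd hII (funext fun a => ?_)
        by_cases ha : a ∈ t.I
        · rw [t.K_eq a ha, t'.K_eq a (hII ▸ ha), hd]
        · rw [hK a ha, hK' a (hII ▸ ha)] }
  | (s, .resp f), v' =>
    { vtx := v'
      sits := A.updateNext G s f v'
      unique := by
        rintro t ⟨u, hu, hdu, -, hI, hK⟩ t' ⟨u', hu', hdu', -, hI', hK'⟩ hd
        obtain rfl : u = u' := s.unique u hu u' hu' (by rw [← hdu, ← hdu', hd])
        have hII : t.I = t'.I := by rw [hI, hI']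
        refine Situation.ext hd hII (funext fun a => ?_)
        by_cases ha : a ∈ t.I
        · rw [t.K_eq a ha, t'.K_eq a (hII ▸ ha), hd]
        · rw [hK a ha, hK' a (hII ▸ ha)] }

/-- The epistemic game of a concurrent game (through its arena) and a communication graph. -/
def epistemicGame [Nonempty Agt] :
    TurnGame (EveState V Agt) (AdamState V Act Agt) (EveAction Act Agt) V where
  init := ⟨A.init, ∅, by simp⟩
  allowE := A.epiAllowE
  allowA := A.epiAllowA
  tabE := Prod.mk
  tabA := A.epiTabA G
  nonblockingE := by
    intro s
    choose m hm using A.allow_nonempty s.vtx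
    by_cases hs : s.sits = ∅
    · exact ⟨.move m, hs, hm⟩
    · classical
      refine ⟨.resp fun d => if d ∈ s.devs then some m else none, hs, ?_, ?_, ?_⟩
      · intro d
        by_cases hd : d ∈ s.devs <;> simp [hd]
      · intro d m' h a
        by_cases hd : d ∈ s.devs
        · simp only [hd, if_true, Option.some.injEq] at h
          exact h ▸ hm a
        · simp [hd] at h
      · intro t ht t' ht' a _ _ m₁ m₂ h₁ h₂
        have h : t.dev ∈ s.devs := ⟨t, ht, rfl⟩
        have h' : t'.dev ∈ s.devs := ⟨t', ht', rfl⟩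
        simp only [h, h', if_true, Option.some.injEq] at h₁ h₂
        rw [← h₁, ← h₂]
  nonblockingA := by
    rintro s (m | f) hf
    · obtain ⟨d⟩ := ‹Nonempty Agt›
      exact ⟨_, d, m d, hf.2 d, rfl⟩
    · obtain ⟨t, ht⟩ := Set.nonempty_iff_ne_empty.2 hf.1
      have hd : t.dev ∈ s.devs := ⟨t, ht, rfl⟩
      obtain ⟨m, hm⟩ := Option.isSome_iff_exists.1 ((hf.2.1 _).2 hd)
      exact ⟨_, t.dev, hd, m, hm, m t.dev, hf.2.2.1 _ _ hm _, rfl⟩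

/-- Adam complies with Eve's suggestions along `R`: whenever Eve has played a move, Adam chooses
the vertex to which this move leads. (Then the set of situations remains empty.) -/
def Complies (R : Play (EveState V Agt) (AdamState V Act Agt)) : Prop :=
  ∀ n m, (R.adam n).2 = .move m → (R.eve (n + 1)).vtx = A.tab (R.adam n).1.vtx m

end Arena

/-- The sequence of vertices visited along a play of the epistemic game. -/
def visited {V Act Agt : Type*} (R : Play (EveState V Agt) (AdamState V Act Agt)) (n : ℕ) : V :=
  (R.eve n).vtx

/-- The set `dev(R)` of possible deviators along `R`: the limit of the sets `dev(Xₙ)`, which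
are all empty, or decreasing from the first nonempty one on. -/
def limDev {V Act Agt : Type*} (R : Play (EveState V Agt) (AdamState V Act Agt)) : Set Agt :=
  {d | ∀ᶠ n in Filter.atTop, d ∈ (R.eve n).devs}

/-- `ζ` is a winning strategy of Eve for payoff `p`; the play `R` is the unique outcome
of `ζ` along which Adam complies with Eve's suggestions. -/
def ConcurrentGame.EveWins {V Act Agt : Type*} [DecidableEq Agt] [Nonempty Agt]
    (𝒢 : ConcurrentGame V Act Agt) (G : Digraph Agt)
    (ζ : EpiHist V Act Agt → EveAction Act Agt) (p : Agt → EReal) : Prop :=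
  (𝒢.epistemicGame G).IsEveStrategy ζ ∧
    ∃ R, (𝒢.epistemicGame G).IsOutcome ζ R ∧ 𝒢.Complies R ∧
      (∀ a, 𝒢.payoff a (visited R) = p a) ∧
      ∀ R', (𝒢.epistemicGame G).IsOutcome ζ R' → R' ≠ R →
        ∀ d ∈ limDev R', 𝒢.payoff d (visited R') ≤ p d

/-! ### Effective transformations of strategies -/

/-- `OracleRun alg ζ i l o`: on input `i`, having already received from the oracle `ζ` the
answers `l` (most recent first), the algorithm `alg` terminates and outputs `o`. From the input
and the answers so far, `alg` computes either the next query or the output. -/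
inductive OracleRun {Q R I O : Type*} (alg : I × List R → Q ⊕ O) (ζ : Q → R) (i : I) :
    List R → O → Prop
  | halt {l : List R} {o : O} : alg (i, l) = .inr o → OracleRun alg ζ i l o
  | ask {l : List R} {o : O} (q : Q) :
      alg (i, l) = .inl q → OracleRun alg ζ i (ζ q :: l) o → OracleRun alg ζ i l o

/-- A single algorithm computes `Φ ζ i` from `i`, for every `ζ`, given oracle access to `ζ`. -/
def Effective {Q R I O : Type*} [Primcodable Q] [Primcodable R] [Primcodable I] [Primcodable O]
    (Φ : (Q → R) → I → O) : Prop :=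
  ∃ alg : I × List R → Q ⊕ O, Computable alg ∧ ∀ ζ i, OracleRun alg ζ i [] (Φ ζ i)

/-- The coding of a finite type by an enumeration. -/
noncomputable abbrev finiteCoding (α : Type*) [Finite α] : Primcodable α :=
  Primcodable.ofEquiv (Fin (Nat.card α)) (Finite.equivFin α)

/-- The coding of a tuple with finitely many components, by the list of its components. -/
noncomputable abbrev tupleCoding (ι α : Type*) [Finite ι] [Primcodable α] : Primcodable (ι → α) :=
  Primcodable.ofEquiv (Fin (Nat.card ι) → α) ((Finite.equivFin ι).arrowCongr (Equiv.refl α))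

instance {Agt : Type*} [Finite Agt] : Finite (Situation Agt) :=
  Finite.of_injective (fun t : Situation Agt => (t.dev, t.I, t.K)) fun t t' h => by
    simp only [Prod.mk.injEq] at h
    exact Situation.ext h.1 h.2.1 h.2.2

instance {V Agt : Type*} [Finite V] [Finite Agt] : Finite (EveState V Agt) :=
  Finite.of_injective (fun s : EveState V Agt => (s.vtx, s.sits)) fun s s' h => by
    simp only [Prod.mk.injEq] at h
    exact EveState.ext h.1 h.2

instance {Act Agt : Type*} [Finite Act] [Finite Agt] : Finite (EveAction Act Agt) :=
  Finite.of_surjective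
    (Sum.elim EveAction.move EveAction.resp :
      (Agt → Act) ⊕ (Agt → Option (Agt → Act)) → EveAction Act Agt) <| by
    rintro (m | f)
    · exact ⟨.inl m, rfl⟩
    · exact ⟨.inr f, rfl⟩

/-- Full histories are coded as lists of steps. -/
noncomputable abbrev fullHistCoding (V Act Agt : Type*) [Finite V] [Finite Act] [Finite Agt] :
    Primcodable (FullHist V Act Agt) :=
  letI := finiteCoding V
  letI := finiteCoding (Agt → Act)
  letI := tupleCoding Agt (List Bool)
  inferInstance

/-- The coding of the joint decision (an action and a message for every player). -/
noncomputable abbrev decisionCoding (Act Agt : Type*) [Finite Act] [Finite Agt] :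
    Primcodable (Agt → Act × List Bool) :=
  letI := finiteCoding Act
  tupleCoding Agt (Act × List Bool)

/-- Histories of the epistemic game are coded as lists over a finite set. -/
noncomputable abbrev epiHistCoding (V Act Agt : Type*) [Finite V] [Finite Act] [Finite Agt] :
    Primcodable (EpiHist V Act Agt) :=
  letI := finiteCoding (AdamState V Act Agt × EveState V Agt)
  inferInstance

/-- A transformation of strategies of Eve into strategy profiles is effective. -/
def EffectiveToProfile {V Act Agt : Type*} [Finite V] [Finite Act] [Finite Agt]
    (Ω : (EpiHist V Act Agt → EveAction Act Agt) → Profile V Act Agt) : Prop :=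
  letI := fullHistCoding V Act Agt
  letI := decisionCoding Act Agt
  letI := epiHistCoding V Act Agt
  letI := finiteCoding (EveAction Act Agt)
  Effective fun ζ (h : FullHist V Act Agt) (a : Agt) => Ω ζ a h

/-- A transformation of strategy profiles into strategies of Eve is effective. -/
def EffectiveToEve {V Act Agt : Type*} [Finite V] [Finite Act] [Finite Agt]
    (Υ : Profile V Act Agt → EpiHist V Act Agt → EveAction Act Agt) : Prop :=
  letI := fullHistCoding V Act Agt
  letI := decisionCoding Act Agt
  letI := epiHistCoding V Act Agt
  letI := finiteCoding (EveAction Act Agt)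
  Effective fun (σ : FullHist V Act Agt → Agt → Act × List Bool) => Υ fun a h => σ h a

end CommGame

/-! Vertices are public, so every player can follow the state of the epistemic game; what is private
is who deviated, and this information travels along the edges at unit speed. In reachable states
(`EveState.IsSpread`) all sets `I_d` are balls of one common radius around their `d`, and an
uninformed player `a` suspects exactly the `b` in `dev(X)` with `a ∉ I_b`, whoever the deviator is.
Hence the constraint on Eve's responses becomes: `f d` and `f d'` agree on every player informed in
neither situation. This is also what indistinguishability of histories demands of a compatible
strategy.

From Eve to profiles (`toProfile`): whoever sees the first visible deviation learns the deviator and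
broadcasts the name, and whoever receives a name passes it on. A deviator `d` cannot spoil this by
lying, since all who hear her are informed at once. Informed players follow `f d`; the others follow
`f d'` for any `d'` that would not have been revealed to them, which gives the same action. So
beliefs stay correct (`Tracks.cons`), a deviation of `d` produces an outcome of Eve's strategy in
which `d` remains a suspect, and the winning condition bounds her payoff (`isNash_toProfile`).

From profiles to Eve (`toEve`): for each suspect `d`, rebuild the full history in which `d` changed
only actions (`simulate`) and let `f d` be what the profile does there. Players informed in neither
of two situations have the same view of both histories (`simulationSpec`), so this is legal.
Conversely, an outcome in which `d` remains a suspect is realised by a compatible deviation of `d`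
(`exists_deviation`), so the equilibrium bounds her payoff (`eveWins_toEve`).

Both maps run along the history with one query per round, `toEve` once for each player. Apart from
words that are copied or decoded, the data of a round are finite, so each step is primitive
recursive. -/

namespace CommGame

/-! ### Oracle algorithms that run along a list -/

section OracleFold

variable {Q R I O S X : Type*}

/-- The state reached from `s` along a list of tokens, with one query to `ζ` per token. -/
def oracleFold (q : S → Q) (step : (S × R) × X → S) (ζ : Q → R) (s : S) (xs : List X) : S :=
  xs.foldl (fun s x => step ((s, ζ (q s)), x)) s

/-- One step of the replay of an oracle computation from a list of answers. The replay stalls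
once the answers are used up. -/
def replayStep (step : (S × R) × X → S) (p : S × List R) (x : X) : S × List R :=
  match p.2 with
  | [] => p
  | r :: rs => (step ((p.1, r), x), rs)

/-- The algorithm that runs along the list of tokens `xs i`, makes one query for each token,
and a final one before it computes the output. -/
def foldAlg (xs : I → List X) (s₀ : S) (q : S → Q) (step : (S × R) × X → S)
    (out : (I × S) × R → O) (p : I × List R) : Q ⊕ O :=
  let t := (xs p.1).foldl (replayStep step) (s₀, p.2.reverse)
  match t.2 with
  | [] => .inl (q t.1)
  | r :: _ => .inr (out ((p.1, t.1), r))

theorem foldl_replayStep_nil (step : (S × R) × X → S) (s : S) (xs : List X) :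
    xs.foldl (replayStep step) (s, []) = (s, []) := by
  induction xs with
  | nil => rfl
  | cons x xs ih => exact ih

/-- Each call replays the run from the answers received so far. The invariant `hl` says that the
tokens `ys` use up exactly the answers `l` and leave any later answers `rs` untouched; with `rs`
empty the algorithm asks, with one answer more it goes on or halts. -/
theorem oracleRun_foldAlg (xs : I → List X) (s₀ : S) (q : S → Q) (step : (S × R) × X → S)
    (out : (I × S) × R → O) (ζ : Q → R) (i : I) (ys zs : List X) (hxs : xs i = ys ++ zs)
    (s : S) (l : List R)
    (hl : ∀ rs, ys.foldl (replayStep step) (s₀, l.reverse ++ rs) = (s, rs)) :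
    OracleRun (foldAlg xs s₀ q step out) ζ i l
      (out ((i, oracleFold q step ζ s zs), ζ (q (oracleFold q step ζ s zs)))) := by
  induction zs generalizing ys s l with
  | nil =>
    refine .ask (q s) ?_ (.halt ?_)
    · have := hl []
      simp only [List.append_nil] at this hxs
      simp [foldAlg, hxs, this]
    · have := hl [ζ (q s)]
      simp only [List.append_nil] at hxs
      simp [foldAlg, hxs, this, oracleFold]
  | cons x zs ih =>
    refine .ask (q s) ?_ ?_
    · have := hl []
      simp only [List.append_nil] at this
      simp only [foldAlg, hxs, List.foldl_append, this, foldl_replayStep_nil]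
    · refine ih (ys ++ [x]) (by simp [hxs]) (step ((s, ζ (q s)), x)) (ζ (q s) :: l) fun rs => ?_
      have := hl (ζ (q s) :: rs)
      simp [this, replayStep]

theorem computable_foldAlg [Primcodable Q] [Primcodable R] [Primcodable I] [Primcodable O]
    [Primcodable S] [Primcodable X] {xs : I → List X} (s₀ : S) {q : S → Q}
    {step : (S × R) × X → S} {out : (I × S) × R → O} (hxs : Primrec xs) (hq : Primrec q)
    (hstep : Primrec step) (hout : Primrec out) :
    Computable (foldAlg xs s₀ q step out) := by
  have hrep : Primrec₂ fun (_ : I × List R) (z : (S × List R) × X) =>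
      replayStep step z.1 z.2 := by
    have : Primrec fun z : (S × List R) × X => replayStep step z.1 z.2 := by
      refine (Primrec.list_casesOn (f := fun z : (S × List R) × X => z.1.2)
        (g := fun z => z.1) (h := fun z y => (step ((z.1.1, y.1), z.2), y.2))
        (Primrec.snd.comp Primrec.fst) Primrec.fst ?_).of_eq ?_
      · refine Primrec.pair (hstep.comp (Primrec.pair (Primrec.pair ?_ ?_) ?_)) ?_
        · exact Primrec.fst.comp (Primrec.fst.comp Primrec.fst)
        · exact Primrec.fst.comp Primrec.snd
        · exact Primrec.snd.comp Primrec.fst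
        · exact Primrec.snd.comp Primrec.snd
      · rintro ⟨⟨s, _ | ⟨r, rs⟩⟩, x⟩ <;> rfl
    exact this.comp Primrec.snd
  have ht : Primrec fun p : I × List R =>
      (xs p.1).foldl (replayStep step) (s₀, p.2.reverse) :=
    Primrec.list_foldl (f := fun p : I × List R => xs p.1) (g := fun p => (s₀, p.2.reverse))
      (h := fun _ z => replayStep step z.1 z.2) (hxs.comp Primrec.fst)
      (Primrec.pair (Primrec.const s₀) (Primrec.list_reverse.comp Primrec.snd)) hrep
  refine Primrec.to_comp ?_
  refine (Primrec.list_casesOn (f := fun p : I × List R =>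
      ((xs p.1).foldl (replayStep step) (s₀, p.2.reverse)).2)
    (g := fun p => (.inl (q ((xs p.1).foldl (replayStep step) (s₀, p.2.reverse)).1) : Q ⊕ O))
    (h := fun p y => .inr (out ((p.1, ((xs p.1).foldl (replayStep step) (s₀, p.2.reverse)).1),
      y.1)))
    (Primrec.snd.comp ht) (Primrec.sumInl.comp (hq.comp (Primrec.fst.comp ht))) ?_).of_eq ?_
  · refine Primrec.sumInr.comp (hout.comp (Primrec.pair (Primrec.pair ?_ ?_) ?_))
    · exact Primrec.fst.comp Primrec.fst
    · exact Primrec.fst.comp (ht.comp Primrec.fst)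
    · exact Primrec.fst.comp Primrec.snd
  · intro p
    unfold foldAlg
    generalize (xs p.1).foldl (replayStep step) (s₀, p.2.reverse) = t
    rcases t with ⟨s, _ | ⟨r, rs⟩⟩ <;> rfl

theorem effective_of_fold [Primcodable Q] [Primcodable R] [Primcodable I] [Primcodable O]
    [Primcodable S] [Primcodable X] {Φ : (Q → R) → I → O} {xs : I → List X} (s₀ : S) {q : S → Q}
    {step : (S × R) × X → S} {out : (I × S) × R → O} (hxs : Primrec xs) (hq : Primrec q)
    (hstep : Primrec step) (hout : Primrec out)
    (hΦ : ∀ ζ i, Φ ζ i = out ((i, oracleFold q step ζ s₀ (xs i)),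
      ζ (q (oracleFold q step ζ s₀ (xs i))))) :
    Effective Φ := by
  refine ⟨foldAlg xs s₀ q step out, computable_foldAlg s₀ hxs hq hstep hout, fun ζ i => ?_⟩
  rw [hΦ]
  exact oracleRun_foldAlg xs s₀ q step out ζ i [] (xs i) rfl s₀ [] fun rs => rfl

end OracleFold

/-! ### Primitive recursive functions of coded tuples. -/

section TupleCoding

variable {ι α β γ : Type*} [Finite ι] [Primcodable α] [Primcodable β] [Primcodable γ]

theorem primrec_tupleCoding_apply (i : ι) :
    letI := tupleCoding ι α
    Primrec fun t : ι → α => t i := by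
  let := tupleCoding ι α
  have h : Primrec ((Finite.equivFin ι).arrowCongr (Equiv.refl α)) := Primrec.of_equiv
  exact (Primrec.fin_app.comp h (Primrec.const (Finite.equivFin ι i))).of_eq fun t => by
    simp [Equiv.arrowCongr]

theorem primrec_tupleCoding_mk {g : γ → ι → α} (hg : ∀ i, Primrec fun c => g c i) :
    letI := tupleCoding ι α
    Primrec g := by
  let := tupleCoding ι α
  refine (Primrec.of_equiv_iff ((Finite.equivFin ι).arrowCongr (Equiv.refl α))).1 ?_
  refine Primrec.fin_curry.2 (Primrec₂.swap (Primrec.fin_curry₁.2 fun k => ?_))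
  exact hg ((Finite.equivFin ι).symm k)

theorem primrec_tupleCoding_map {f : α → β} (hf : Primrec f) :
    letI := tupleCoding ι α
    letI := tupleCoding ι β
    Primrec fun (t : ι → α) i => f (t i) :=
  let := tupleCoding ι α
  primrec_tupleCoding_mk fun i => hf.comp (primrec_tupleCoding_apply i)

/-- If the components have finite range, every coding of the tuples of values will do. -/
theorem primrec_tupleCoding_map_finite [Finite β] [inst : Primcodable (ι → β)] {f : α → β}
    (hf : Primrec f) :
    letI := tupleCoding ι α
    Primrec fun (t : ι → α) i => f (t i) := by
  exact @Primrec.comp _ _ _ (tupleCoding ι α) (tupleCoding ι β) inst id _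
    (@Primrec.dom_finite _ _ (tupleCoding ι β) inst _ id) (primrec_tupleCoding_map hf)

end TupleCoding

/-! ### Distances in the communication graph -/

section Distance

variable {Agt : Type*} {G : Digraph Agt}

theorem gdist_le_of_path {n : ℕ} {a b : Agt} (h : PathOfLength G n a b) : gdist G a b ≤ n :=
  iInf₂_le n h

theorem exists_path_of_gdist_le {n : ℕ} {a b : Agt} (h : gdist G a b ≤ n) :
    ∃ k ≤ n, PathOfLength G k a b := by
  by_contra! hk
  have : ((n + 1 : ℕ) : ℕ∞) ≤ gdist G a b :=
    le_iInf₂ fun k hp => by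
      have : n < k := by
        by_contra! hkn
        exact hk k hkn hp
      exact_mod_cast this
  have := this.trans h
  rw [Nat.cast_le] at this
  omega

theorem gdist_le_one_iff {a b : Agt} : gdist G a b ≤ (1 : ℕ) ↔ Hears G a b := by
  constructor
  · intro h
    obtain ⟨k, hk, hp⟩ := exists_path_of_gdist_le h
    interval_cases k
    · exact .inr hp
    · obtain ⟨c, rfl, hc⟩ := hp
      exact .inl hc
  · rintro (h | rfl)
    · exact gdist_le_of_path (n := 1) ⟨a, rfl, h⟩
    · exact (gdist_le_of_path (n := 0) rfl).trans (by simp)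

theorem gdist_le_add_one_of_hears {n : ℕ} {a b c : Agt} (h : gdist G a b ≤ n)
    (hbc : Hears G b c) : gdist G a c ≤ (n + 1 : ℕ) := by
  obtain ⟨k, hk, hp⟩ := exists_path_of_gdist_le h
  obtain hbc | rfl := hbc
  · exact (gdist_le_of_path (n := k + 1) ⟨b, hp, hbc⟩).trans (by exact_mod_cast by omega)
  · exact h.trans (by exact_mod_cast by omega)

theorem exists_hears_of_gdist_le_add_one {n : ℕ} {a c : Agt} (h : gdist G a c ≤ (n + 1 : ℕ)) :
    ∃ b, gdist G a b ≤ n ∧ Hears G b c := by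
  obtain ⟨k, hk, hp⟩ := exists_path_of_gdist_le h
  cases k with
  | zero => exact ⟨c, (gdist_le_of_path hp).trans (by simp), .inr rfl⟩
  | succ k =>
    obtain ⟨b, hab, hbc⟩ := hp
    exact ⟨b, (gdist_le_of_path hab).trans (by exact_mod_cast by omega), .inl hbc⟩

/-- The players that a ball informs in one more step, in terms of the radius of the ball. -/
theorem gdist_le_iSup_ball_iff {n : ℕ} {I : Set Agt} {c a : Agt}
    (hI : I = {b | gdist G c b ≤ n}) :
    gdist G c a ≤ (⨆ b ∈ I, gdist G c b) + 1 ↔ a ∈ I ∪ {a | ∃ b ∈ I, Hears G b a} := by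
  constructor
  · intro h
    have hsup : (⨆ b ∈ I, gdist G c b) ≤ n := iSup₂_le fun b hb => by simpa [hI] using hb
    have h' : gdist G c a ≤ (n + 1 : ℕ) := h.trans (by push_cast; gcongr)
    obtain ⟨b, hb, hba⟩ := exists_hears_of_gdist_le_add_one h'
    exact .inr ⟨b, by simpa [hI] using hb, hba⟩
  · have key : ∀ b ∈ I, ∀ a, Hears G b a → gdist G c a ≤ (⨆ b ∈ I, gdist G c b) + 1 := by
      intro b hb a hba
      have hb' : gdist G c b ≤ n := by simpa [hI] using hb
      -- The exact distance `k` of `b` is needed: the supremum over the ball can be smaller than the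
      -- radius `n`.
      obtain ⟨k, hk⟩ := ENat.ne_top_iff_exists.1 (ne_top_of_le_ne_top (ENat.natCast_ne_top n) hb')
      have h1 := gdist_le_add_one_of_hears hk.ge hba
      have h2 : gdist G c b ≤ ⨆ b ∈ I, gdist G c b :=
        le_iSup₂ (f := fun b (_ : b ∈ I) => gdist G c b) b hb
      rw [← hk] at h2
      exact h1.trans (by push_cast; gcongr)
    rintro (ha | ⟨b, hb, hba⟩)
    · exact key a ha a (.inr rfl)
    · exact key b hb a hba

end Distance

/-! ### Knowledge in the reachable states of the epistemic game -/

/-- The updates prescribe `K` only outside `I`; overwriting `K` by `{d}` on `I` gives a genuine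
situation, so they are inhabited whenever `d` is not excluded. -/
theorem exists_situation {Agt : Type*} (d : Agt) (I : Set Agt) (hd : d ∈ I)
    (K : Agt → Set Agt) :
    ∃ t : Situation Agt, t.dev = d ∧ t.I = I ∧ ∀ a ∉ t.I, t.K a = K a := by
  classical
  exact ⟨⟨d, I, fun a => if a ∈ I then {d} else K a, hd, fun a ha => if_pos ha⟩, rfl, rfl,
    fun a ha => if_neg ha⟩

/-- Information about the deviator spreads at unit speed, and the players not yet informed
suspect exactly those deviators that would not have been revealed to them. -/
def EveState.IsSpread {V Agt : Type*} (G : Digraph Agt) (s : EveState V Agt) : Prop :=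
  ∃ n : ℕ, 1 ≤ n ∧ ∀ u ∈ s.sits, u.I = {a | gdist G u.dev a ≤ n} ∧
    ∀ a ∉ u.I, u.K a = {b | ∃ w ∈ s.sits, w.dev = b ∧ a ∉ w.I}

/-- The radius is at least one. Thus uninformed players never hear the deviator, and neither her
actions nor her false messages reach them directly. -/
theorem EveState.IsSpread.mem_I_of_hears {V Agt : Type*} {G : Digraph Agt} {s : EveState V Agt}
    (hs : s.IsSpread G) {u : Situation Agt} (hu : u ∈ s.sits) {a : Agt} (ha : Hears G u.dev a) :
    a ∈ u.I := by
  obtain ⟨n, hn, h⟩ := hs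
  rw [(h u hu).1]
  exact (gdist_le_one_iff.2 ha).trans (by exact_mod_cast hn)

/-- The suspect set of an uninformed player does not mention the actual deviator. This makes the
hypothesis on `K` in Eve's constraint automatic in reachable states. -/
theorem EveState.IsSpread.K_eq_K {V Agt : Type*} {G : Digraph Agt} {s : EveState V Agt}
    (hs : s.IsSpread G) {t t' : Situation Agt} (ht : t ∈ s.sits) (ht' : t' ∈ s.sits) {a : Agt}
    (ha : a ∉ t.I ∪ t'.I) : t.K a = t'.K a := by
  obtain ⟨n, -, h⟩ := hs
  rw [Set.mem_union, not_or] at ha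
  rw [(h t ht).2 a ha.1, (h t' ht').2 a ha.2]

namespace Arena

section

variable {V Act Agt : Type*} {A : Arena V Act Agt}

theorem exists_move_of_sits_eq_empty {s : EveState V Agt} {x : EveAction Act Agt}
    (hx : x ∈ A.epiAllowE s) (hs : s.sits = ∅) : ∃ m, x = .move m := by
  cases x with
  | move m => exact ⟨m, rfl⟩
  | resp f => exact absurd hs hx.1

theorem exists_resp_of_sits_ne_empty {s : EveState V Agt} {x : EveAction Act Agt}
    (hx : x ∈ A.epiAllowE s) (hs : s.sits ≠ ∅) : ∃ f, x = .resp f := by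
  cases x with
  | move m => exact absurd hx.1 hs
  | resp f => exact ⟨f, rfl⟩

end

variable {V Act Agt : Type*} [DecidableEq Agt] (A : Arena V Act Agt) (G : Digraph Agt)

theorem exists_mem_updateFirst {v v' : V} {m : Agt → Act} {d : Agt} (hv : A.tab v m ≠ v')
    (hd : A.CanReach v m d v') : ∃ t ∈ A.updateFirst G v m v', t.dev = d := by
  obtain ⟨t, rfl, hI, hK⟩ := exists_situation d {a | Hears G d a} (.inr rfl)
    fun a => {b | A.CanReach v m b v'} \ {b | Hears G b a}
  exact ⟨t, ⟨hv, hd, hI, hK⟩, rfl⟩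

theorem exists_mem_updateNext {s : EveState V Agt} {f : Agt → Option (Agt → Act)} {v' : V}
    {u : Situation Agt} (hu : u ∈ s.sits) {m : Agt → Act} (hm : f u.dev = some m)
    (hr : A.CanReach s.vtx m u.dev v') : ∃ t ∈ A.updateNext G s f v', t.dev = u.dev ∧
      t.I = u.I ∪ {a | ∃ b ∈ u.I, Hears G b a} := by
  obtain ⟨t, hd, hI, hK⟩ := exists_situation u.dev (u.I ∪ {a | ∃ b ∈ u.I, Hears G b a})
    (.inl u.dev_mem) fun a => {b ∈ u.K a | ∃ m, f b = some m ∧ A.CanReach s.vtx m b v'} \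
      {c | ∃ w ∈ s.sits, w.dev = c ∧ gdist G c a ≤ (⨆ c' ∈ w.I, gdist G c c') + 1}
  exact ⟨t, ⟨u, hu, hd, ⟨m, hm, hr⟩, hI, hK⟩, hd, hI⟩

theorem isSpread_epiTabA_move (s : EveState V Agt) (m : Agt → Act) (v' : V) :
    (A.epiTabA G (s, .move m) v').IsSpread G := by
  refine ⟨1, le_rfl, ?_⟩
  rintro u ⟨hv, -, hI, hK⟩
  refine ⟨by rw [hI]; ext a; exact gdist_le_one_iff.symm, fun a ha => ?_⟩
  rw [hK a ha]
  ext b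
  constructor
  · rintro ⟨hb, hba⟩
    obtain ⟨w, hw, rfl⟩ := A.exists_mem_updateFirst G hv hb
    refine ⟨w, hw, rfl, ?_⟩
    rw [hw.2.2.1]
    exact hba
  · rintro ⟨w, ⟨-, hb, hwI, -⟩, rfl, haw⟩
    rw [hwI] at haw
    exact ⟨hb, haw⟩

/-- One more round of communication enlarges every ball by one. The suspects removed by the distance
test are those whose enlarged ball contains `a` (`gdist_le_iSup_ball_iff`), and the reachability
test leaves exactly the new `dev(X)`. -/
theorem isSpread_epiTabA_resp {s : EveState V Agt} (hs : s.IsSpread G)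
    (f : Agt → Option (Agt → Act)) (v' : V) :
    (A.epiTabA G (s, .resp f) v').IsSpread G := by
  obtain ⟨n, hn, h⟩ := hs
  refine ⟨n + 1, by omega, ?_⟩
  rintro t ⟨u, hu, hdu, -, hI, hK⟩
  have hball : ∀ w ∈ s.sits, w.I ∪ {a | ∃ b ∈ w.I, Hears G b a} =
      {a | gdist G w.dev a ≤ (n + 1 : ℕ)} := by
    intro w hw
    rw [(h w hw).1]
    ext a
    constructor
    · rintro (ha | ⟨b, hb, hba⟩)
      · exact gdist_le_add_one_of_hears ha (.inr rfl)
      · exact gdist_le_add_one_of_hears hb hba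
    · intro ha
      obtain ⟨b, hb, hba⟩ := exists_hears_of_gdist_le_add_one ha
      exact .inr ⟨b, hb, hba⟩
  refine ⟨by rw [hI, hball u hu, hdu], fun a ha => ?_⟩
  have hau : a ∉ u.I := fun h' => ha (hI ▸ .inl h')
  rw [hK a ha, (h u hu).2 a hau]
  ext b
  constructor
  · rintro ⟨⟨⟨w, hw, rfl, haw⟩, m, hm, hr⟩, hb⟩
    obtain ⟨w', hw', hd', hI'⟩ := A.exists_mem_updateNext G hw hm hr
    refine ⟨w', hw', hd', fun ha' => hb ⟨w, hw, rfl, ?_⟩⟩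
    rwa [gdist_le_iSup_ball_iff (h w hw).1, ← hI']
  · rintro ⟨w', ⟨w, hw, hdw, ⟨m, hm, hr⟩, hI', -⟩, rfl, haw⟩
    rw [hI'] at haw
    refine ⟨⟨⟨w, hw, hdw.symm, fun h' => haw (.inl h')⟩, m, hdw ▸ hm, hdw ▸ hr⟩, ?_⟩
    rintro ⟨w₂, hw₂, hd₂, hle⟩
    obtain rfl := s.unique w₂ hw₂ w hw (hd₂.trans hdw)
    rw [hdw, gdist_le_iSup_ball_iff (h w₂ hw₂).1] at hle
    exact haw hle

@[simp] theorem vtx_epiTabA (x : AdamState V Act Agt) (v' : V) :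
    (A.epiTabA G x v').vtx = v' := by
  obtain ⟨s, m | f⟩ := x <;> rfl

theorem sits_epiTabA_move_eq_empty_iff {s : EveState V Agt} {m : Agt → Act} {v' : V}
    (hv' : v' ∈ A.epiAllowA (s, .move m)) :
    (A.epiTabA G (s, .move m) v').sits = ∅ ↔ v' = A.tab s.vtx m := by
  constructor
  · intro h
    by_contra hne
    obtain ⟨d, hd⟩ := hv'
    obtain ⟨t, ht, -⟩ := A.exists_mem_updateFirst G (Ne.symm hne) hd
    exact Set.notMem_empty t (h ▸ ht)
  · rintro rfl
    exact Set.eq_empty_of_forall_notMem fun t ht => ht.1 rfl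

theorem sits_epiTabA_resp_nonempty {s : EveState V Agt} {f : Agt → Option (Agt → Act)} {v' : V}
    (hv' : v' ∈ A.epiAllowA (s, .resp f)) : (A.epiTabA G (s, .resp f) v').sits.Nonempty := by
  obtain ⟨d, ⟨u, hu, rfl⟩, m, hm, hr⟩ := hv'
  obtain ⟨t, ht, -⟩ := A.exists_mem_updateNext G hu hm hr
  exact ⟨t, ht⟩

variable [Nonempty Agt]

theorem isSpread_last {H : EpiHist V Act Agt} (hH : (A.epistemicGame G).IsHist H) :
    ((A.epistemicGame G).last H).IsSpread G := by
  induction H with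
  | nil => exact ⟨1, le_rfl, fun u hu => absurd hu (Set.notMem_empty u)⟩
  | cons x H ih =>
    obtain ⟨t, s⟩ := x
    obtain ⟨hH, ⟨f, -, rfl⟩, v', -, rfl⟩ := hH
    cases f with
    | move m => exact A.isSpread_epiTabA_move G _ m v'
    | resp f => exact A.isSpread_epiTabA_resp G (ih hH) f v'

end Arena

/-! ### Plays of the epistemic game -/

namespace TurnGame

variable {SE SA AE AA : Type*} (E : TurnGame SE SA AE AA)

theorem last_hist {ζ : List (SA × SE) → AE} {R : Play SE SA} (hR : E.IsOutcome ζ R) (n : ℕ) :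
    E.last (R.hist n) = R.eve n := by
  cases n with
  | zero => exact hR.1.symm
  | succ n => rfl

theorem isHist_hist {ζ : List (SA × SE) → AE} (hζ : E.IsEveStrategy ζ) {R : Play SE SA}
    (hR : E.IsOutcome ζ R) (n : ℕ) : E.IsHist (R.hist n) := by
  induction n with
  | zero => trivial
  | succ n ih =>
    have h := hR.2 n
    rw [← E.last_hist hR n] at h
    exact ⟨ih, ⟨_, hζ _ ih, h.1⟩, h.2⟩

end TurnGame

namespace Arena

variable {V Act Agt : Type*} [DecidableEq Agt] [Nonempty Agt] {A : Arena V Act Agt}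
  {G : Digraph Agt} {ζ : EpiHist V Act Agt → EveAction Act Agt}

/-- The relation between consecutive states of Eve along an outcome. -/
theorem eve_succ {R : Play (EveState V Agt) (AdamState V Act Agt)}
    (hR : (A.epistemicGame G).IsOutcome ζ R) (n : ℕ) :
    R.adam n = (R.eve n, ζ (R.hist n)) ∧ (R.eve (n + 1)).vtx ∈ A.epiAllowA (R.adam n) ∧
      R.eve (n + 1) = A.epiTabA G (R.adam n) (R.eve (n + 1)).vtx := by
  obtain ⟨h, v', hv', h'⟩ := hR.2 n
  have h' : R.eve (n + 1) = A.epiTabA G (R.adam n) v' := h'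
  have : (R.eve (n + 1)).vtx = v' := by rw [h', vtx_epiTabA]
  exact ⟨h, this ▸ hv', this ▸ h'⟩

theorem zeta_mem (hζ : (A.epistemicGame G).IsEveStrategy ζ)
    {R : Play (EveState V Agt) (AdamState V Act Agt)}
    (hR : (A.epistemicGame G).IsOutcome ζ R) (n : ℕ) :
    ζ (R.hist n) ∈ A.epiAllowE (R.eve n) := by
  have := hζ _ ((A.epistemicGame G).isHist_hist hζ hR n)
  rwa [(A.epistemicGame G).last_hist hR n] at this

/-- The first vertex off the suggested move creates a situation, and without situations Eve must
play a move. Compliance thus becomes a property of the states alone. -/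
theorem complies_iff (hζ : (A.epistemicGame G).IsEveStrategy ζ)
    {R : Play (EveState V Agt) (AdamState V Act Agt)}
    (hR : (A.epistemicGame G).IsOutcome ζ R) :
    A.Complies R ↔ ∀ n, (R.eve n).sits = ∅ := by
  constructor
  · intro hc n
    induction n with
    | zero => rw [hR.1]; rfl
    | succ n ih =>
      obtain ⟨m, hm⟩ := exists_move_of_sits_eq_empty (zeta_mem hζ hR n) ih
      obtain ⟨h1, h2, h3⟩ := eve_succ hR n
      rw [hm] at h1
      have := hc n m (by rw [h1])
      rw [h1] at h2 h3 this
      rw [h3, A.sits_epiTabA_move_eq_empty_iff G h2, this]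
  · intro h n m hm
    obtain ⟨h1, h2, h3⟩ := eve_succ hR n
    have h1' : R.adam n = (R.eve n, .move m) := by rw [← hm, h1]
    have := h (n + 1)
    rw [h1'] at h2 h3
    rw [h3, A.sits_epiTabA_move_eq_empty_iff G h2] at this
    rw [h1', this]

/-- Compliance fixes Adam's choices. States and histories are compared together because Eve's
strategy reads the whole history. -/
theorem eq_of_complies (hζ : (A.epistemicGame G).IsEveStrategy ζ)
    {R R' : Play (EveState V Agt) (AdamState V Act Agt)}
    (hR : (A.epistemicGame G).IsOutcome ζ R) (hR' : (A.epistemicGame G).IsOutcome ζ R')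
    (hc : A.Complies R) (hc' : A.Complies R') : R = R' := by
  have key : ∀ n, R.eve n = R'.eve n ∧ R.hist n = R'.hist n := by
    intro n
    induction n with
    | zero => exact ⟨hR.1.trans hR'.1.symm, rfl⟩
    | succ n ih =>
      obtain ⟨m, hm⟩ := exists_move_of_sits_eq_empty (zeta_mem hζ hR n)
        ((complies_iff hζ hR).1 hc n)
      obtain ⟨h1, -, h3⟩ := eve_succ hR n
      obtain ⟨h1', -, h3'⟩ := eve_succ hR' n
      rw [← ih.1, ← ih.2, ← h1] at h1'
      have e : R.eve (n + 1) = R'.eve (n + 1) := by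
        rw [h3, h3', h1', hc n m (by rw [h1, hm]), hc' n m (by rw [h1', h1, hm]), h1']
      exact ⟨e, by simp only [Play.hist, e, ih.2, h1']⟩
  refine Play.ext (funext fun n => (key n).1) (funext fun n => ?_)
  rw [(eve_succ hR n).1, (eve_succ hR' n).1, (key n).1, (key n).2]

/-- Once Adam has not complied, the sets of possible deviators are nonempty and decrease. -/
theorem devs_succ_subset (hζ : (A.epistemicGame G).IsEveStrategy ζ)
    {R : Play (EveState V Agt) (AdamState V Act Agt)}
    (hR : (A.epistemicGame G).IsOutcome ζ R) {n : ℕ} (hn : (R.eve n).sits ≠ ∅) :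
    (R.eve (n + 1)).sits ≠ ∅ ∧ (R.eve (n + 1)).devs ⊆ (R.eve n).devs := by
  obtain ⟨f, hf⟩ := exists_resp_of_sits_ne_empty (zeta_mem hζ hR n) hn
  obtain ⟨h1, h2, h3⟩ := eve_succ hR n
  rw [hf] at h1
  rw [h1] at h2 h3
  refine ⟨h3 ▸ (A.sits_epiTabA_resp_nonempty G h2).ne_empty, ?_⟩
  rintro d ⟨t, ht, rfl⟩
  rw [h3] at ht
  obtain ⟨u, hu, hd, -⟩ := ht
  exact ⟨u, hu, hd.symm⟩

theorem mem_devs_of_mem_limDev (hζ : (A.epistemicGame G).IsEveStrategy ζ)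
    {R : Play (EveState V Agt) (AdamState V Act Agt)}
    (hR : (A.epistemicGame G).IsOutcome ζ R) {d : Agt} (hd : d ∈ limDev R) {n : ℕ}
    (hn : (R.eve n).sits ≠ ∅) : d ∈ (R.eve n).devs := by
  have hne : ∀ k, (R.eve (n + k)).sits ≠ ∅ := by
    intro k
    induction k with
    | zero => exact hn
    | succ k ih => exact (devs_succ_subset hζ hR ih).1
  have hsub : ∀ k, (R.eve (n + k)).devs ⊆ (R.eve n).devs := by
    intro k
    induction k with
    | zero => exact subset_rfl
    | succ k ih => exact (devs_succ_subset hζ hR (hne k)).2.trans ih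
  obtain ⟨N, hN⟩ := Filter.eventually_atTop.1 hd
  exact hsub N (hN (n + N) (by omega))

end Arena

/-! ### From strategies of Eve to strategy profiles -/

open Classical in
/-- Some element with the property `p`, if there is one. -/
noncomputable def pickWhere {α : Type*} (p : α → Prop) : Option α :=
  if h : ∃ b, p b then some h.choose else none

theorem pickWhere_eq_none {α : Type*} {p : α → Prop} (h : ∀ b, ¬ p b) : pickWhere p = none :=
  dif_neg (by simpa using h)

theorem exists_pickWhere_eq_some {α : Type*} {p : α → Prop} (h : ∃ b, p b) :
    ∃ b, pickWhere p = some b ∧ p b :=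
  ⟨h.choose, dif_pos h, h.choose_spec⟩

/-! ### Coding of suspects by words. -/

section Messages

variable {Agt : Type*} [Finite Agt]

/-- The word by which a player tells who is the deviator. -/
noncomputable def encodeMsg : Option Agt → List Bool
  | none => List.replicate (Nat.card Agt) true
  | some d => List.replicate (Finite.equivFin Agt d) true

/-- The deviator that a word stands for. -/
noncomputable def decodeMsg (w : List Bool) : Option Agt :=
  (List.ofFn (Finite.equivFin Agt).symm)[w.length]?

theorem primrec_decodeMsg [Primcodable Agt] :
    Primrec (decodeMsg : List Bool → Option Agt) :=
  (Primrec.list_getElem?₁ _).comp Primrec.list_length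

-- Players are coded in unary by their index; the code of `none` has length `Nat.card Agt`, just
-- beyond the end of the list, so that the look-up fails.
@[simp] theorem decodeMsg_encodeMsg (o : Option Agt) : decodeMsg (encodeMsg o) = o := by
  cases o <;> simp [decodeMsg, encodeMsg]

end Messages

namespace Arena

section

variable {V Act Agt : Type*} (A : Arena V Act Agt) (G : Digraph Agt)

/-- The action of player `a` when Eve plays `x` in `s`, if `a` believes `bel`. Uninformed
players assume any deviator that would not have been revealed to them. -/
noncomputable def suggestion (s : EveState V Agt) (a : Agt) (bel : Option Agt) :
    EveAction Act Agt → Option Act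
  | .move m => some (m a)
  | .resp f =>
    let target := bel.orElse fun _ =>
      (pickWhere fun t : Situation Agt => t ∈ s.sits ∧ a ∉ t.I).map Situation.dev
    (target.bind f).map fun m => m a

open Classical in
/-- The given action, or any available one if it is not available. -/
noncomputable def makeAllowed (v : V) (a : Agt) (x : Option Act) : Act :=
  if h : ∃ y ∈ A.allow v a, x = some y then h.choose else (A.allow_nonempty v a).some

theorem makeAllowed_mem (v : V) (a : Agt) (x : Option Act) :
    A.makeAllowed v a x ∈ A.allow v a := by
  unfold makeAllowed
  split_ifs with h
  · exact h.choose_spec.1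
  · exact Set.Nonempty.some_mem _

theorem makeAllowed_some {v : V} {a : Agt} {y : Act} (hy : y ∈ A.allow v a) :
    A.makeAllowed v a (some y) = y := by
  have h : ∃ z ∈ A.allow v a, some y = some z := ⟨y, hy, rfl⟩
  unfold makeAllowed
  rw [dif_pos h]
  exact (Option.some.inj h.choose_spec.2).symm

/-- How the belief of player `a` about the deviator evolves: she learns it by observing the
first visible deviation, or from the first meaningful message afterwards. -/
noncomputable def beliefStep (s : EveState V Agt) (x : EveAction Act Agt) (bel : Agt → Option Agt)
    (m : Agt → Act) (code : Agt → Option Agt) (v' : V) (a : Agt) : Option Agt :=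
  match x with
  | .move m₀ => pickWhere fun b => A.tab s.vtx m₀ ≠ v' ∧ Hears G b a ∧ m b ≠ m₀ b
  | .resp _ => (bel a).orElse fun _ =>
      (pickWhere fun b => Hears G b a ∧ (code b).isSome).bind code

/-- `pickWhere` depends on its predicate only, and both predicates inspect only players heard by
`a`. This is the inductive step for compatibility. -/
theorem beliefStep_congr (s : EveState V Agt) (x : EveAction Act Agt) {bel bel' : Agt → Option Agt}
    {m m' : Agt → Act} {code code' : Agt → Option Agt} (v' : V) {a : Agt} (hb : bel a = bel' a)
    (hm : ∀ b, Hears G b a → m b = m' b) (hc : ∀ b, Hears G b a → code b = code' b) :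
    A.beliefStep G s x bel m code v' a = A.beliefStep G s x bel' m' code' v' a := by
  cases x with
  | move m₀ =>
    refine congrArg pickWhere (funext fun b => ?_)
    by_cases h : Hears G b a
    · rw [hm b h]
    · simp [h]
  | resp f =>
    have h1 : (fun b => Hears G b a ∧ (code b).isSome = true) =
        fun b => Hears G b a ∧ (code' b).isSome = true := by
      funext b
      by_cases h : Hears G b a
      · rw [hc b h]
      · simp [h]
    simp only [beliefStep, hb, h1]
    congr 1
    funext _
    by_cases h : ∃ b, Hears G b a ∧ (code' b).isSome = true
    · obtain ⟨b, hb', h2, -⟩ := exists_pickWhere_eq_some h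
      rw [hb']
      exact hc b h2
    · rw [pickWhere_eq_none (not_exists.1 h)]
      rfl

end

variable {V Act Agt : Type*} [DecidableEq Agt] (A : Arena V Act Agt) (G : Digraph Agt)

/-! ### The epistemic history that follows a full history. -/

section Track

variable [Nonempty Agt] (ζ : EpiHist V Act Agt → EveAction Act Agt)

/-- The history of the epistemic game in which Eve plays `ζ` and Adam chooses the vertices of
the given full history. -/
def track : FullHist V Act Agt → EpiHist V Act Agt
  | [] => []
  | x :: h => (((A.epistemicGame G).last (track h), ζ (track h)),
      A.epiTabA G ((A.epistemicGame G).last (track h), ζ (track h)) x.2.2) :: track h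

/-- The state of Eve after `track`. -/
def trackState (h : FullHist V Act Agt) : EveState V Agt :=
  (A.epistemicGame G).last (A.track G ζ h)

/-- The action of Eve after `track`. -/
def trackAct (h : FullHist V Act Agt) : EveAction Act Agt := ζ (A.track G ζ h)

@[simp] theorem vtx_trackState (h : FullHist V Act Agt) :
    (A.trackState G ζ h).vtx = A.last h := by
  cases h with
  | nil => rfl
  | cons x h => exact A.vtx_epiTabA G _ _

theorem trackState_cons (x : (Agt → Act) × Messages Agt × V) (h : FullHist V Act Agt) :
    A.trackState G ζ (x :: h) =
      A.epiTabA G (A.trackState G ζ h, A.trackAct G ζ h) x.2.2 := rfl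

variable {ζ} in
theorem isHist_track_cons (hζ : (A.epistemicGame G).IsEveStrategy ζ)
    {x : (Agt → Act) × Messages Agt × V} {h : FullHist V Act Agt}
    (hh : (A.epistemicGame G).IsHist (A.track G ζ h))
    (hx : x.2.2 ∈ A.epiAllowA (A.trackState G ζ h, A.trackAct G ζ h)) :
    (A.epistemicGame G).IsHist (A.track G ζ (x :: h)) :=
  ⟨hh, ⟨_, hζ _ hh, rfl⟩, _, hx, rfl⟩

variable {ζ} in
theorem trackAct_mem (hζ : (A.epistemicGame G).IsEveStrategy ζ) {h : FullHist V Act Agt}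
    (hh : (A.epistemicGame G).IsHist (A.track G ζ h)) :
    A.trackAct G ζ h ∈ A.epiAllowE (A.trackState G ζ h) := hζ _ hh

/-- The play of the epistemic game in which Eve plays `ζ` and Adam chooses the vertices of the
outcome of `σ`. -/
def trackPlay (σ : Profile V Act Agt) : Play (EveState V Agt) (AdamState V Act Agt) where
  eve n := A.trackState G ζ (A.out σ n)
  adam n := (A.trackState G ζ (A.out σ n), A.trackAct G ζ (A.out σ n))

theorem hist_trackPlay (σ : Profile V Act Agt) (n : ℕ) :
    (A.trackPlay G ζ σ).hist n = A.track G ζ (A.out σ n) := by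
  induction n with
  | zero => rfl
  | succ n ih =>
    rw [Play.hist, ih]
    rfl

theorem visited_trackPlay (σ : Profile V Act Agt) :
    visited (A.trackPlay G ζ σ) = A.outVertices σ :=
  funext fun _ => A.vtx_trackState G ζ _

theorem isOutcome_trackPlay {σ : Profile V Act Agt}
    (h : ∀ n, (A.epistemicGame G).IsHist (A.track G ζ (A.out σ n))) :
    (A.epistemicGame G).IsOutcome ζ (A.trackPlay G ζ σ) := by
  refine ⟨rfl, fun n => ⟨?_, ?_⟩⟩
  · rw [hist_trackPlay]
    rfl
  · exact (h (n + 1)).2.2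

end Track

/-! ### The profile built from Eve's strategy is an equilibrium. -/

section Profile

variable [Nonempty Agt] [Finite Agt] (ζ : EpiHist V Act Agt → EveAction Act Agt)

/-- The beliefs of the players after a full history. -/
noncomputable def belief : FullHist V Act Agt → Agt → Option Agt
  | [] => fun _ => none
  | x :: h => A.beliefStep G (A.trackState G ζ h) (A.trackAct G ζ h) (belief h) x.1
      (fun b => decodeMsg (x.2.1 b)) x.2.2

/-- The profile in which the players play as Eve suggests given their beliefs, and broadcast
these beliefs. -/
noncomputable def toProfile : Profile V Act Agt := fun a h =>
  (A.makeAllowed (A.trackState G ζ h).vtx a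
    (suggestion (A.trackState G ζ h) a (A.belief G ζ h a) (A.trackAct G ζ h)),
  encodeMsg (A.belief G ζ h a))

theorem isStrategy_toProfile (a : Agt) : A.IsStrategy a (A.toProfile G ζ a) := fun h _ => by
  rw [← A.vtx_trackState G ζ h]
  exact A.makeAllowed_mem _ _ _

/-- `track` reads nothing but the vertices, which everybody sees; the belief of `a` evolves by what
`a` observes. -/
theorem isCompatible_toProfile (a : Agt) : A.IsCompatible G a (A.toProfile G ζ a) := by
  have key : ∀ h h' : FullHist V Act Agt, proj G a h = proj G a h' →
      A.track G ζ h = A.track G ζ h' ∧ A.belief G ζ h a = A.belief G ζ h' a := by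
    intro h
    induction h with
    | nil =>
      rintro (_ | ⟨y, h'⟩) hp
      · exact ⟨rfl, rfl⟩
      · simp [proj] at hp
    | cons x h ih =>
      rintro (_ | ⟨y, h'⟩) hp
      · simp [proj] at hp
      obtain ⟨m, c, v⟩ := x
      obtain ⟨m', c', v'⟩ := y
      simp only [proj, List.map_cons, List.cons.injEq, Prod.mk.injEq] at hp
      obtain ⟨⟨hm, hc, rfl⟩, hp⟩ := hp
      obtain ⟨ht, hb⟩ := ih h' hp
      refine ⟨by simp only [track, ht], ?_⟩
      simp only [belief, trackState, trackAct, ht]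
      exact A.beliefStep_congr G _ _ _ hb (fun b hb => congrFun hm ⟨b, hb⟩)
        fun b hb => by rw [congrFun hc ⟨b, hb⟩]
  intro h h' _ _ hp
  obtain ⟨ht, hb⟩ := key h h' hp
  simp only [toProfile, trackState, trackAct, ht, hb]

/-- The full history `h` is one in which `d` is the only deviator, and the players' beliefs
are what they should be. -/
structure Tracks (d : Agt) (h : FullHist V Act Agt) : Prop where
  isHist : A.IsHist h
  isHist_track : (A.epistemicGame G).IsHist (A.track G ζ h)
  belief : (A.trackState G ζ h).sits ≠ ∅ → ∃ t ∈ (A.trackState G ζ h).sits, t.dev = d ∧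
    (∀ a ∈ t.I, A.belief G ζ h a = some d) ∧ ∀ a ∉ t.I, A.belief G ζ h a = none

theorem tracks_nil (d : Agt) : A.Tracks G ζ d [] := ⟨trivial, trivial, fun h => absurd rfl h⟩

variable {A G ζ}

theorem toProfile_of_move {h : FullHist V Act Agt} {m : Agt → Act}
    (hm : A.trackAct G ζ h = .move m) (hall : ∀ a, m a ∈ A.allow (A.trackState G ζ h).vtx a)
    (a : Agt) : (A.toProfile G ζ a h).1 = m a := by
  simp only [toProfile, hm, suggestion]
  exact A.makeAllowed_some (hall a)

/-- An uninformed player may have chosen a situation `t'` other than the true `t`. As she is outside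
`t'.I ∪ t.I`, Eve's constraint gives the same action in both. -/
theorem toProfile_of_resp {h : FullHist V Act Agt} {f : Agt → Option (Agt → Act)}
    (hf : A.trackAct G ζ h = .resp f)
    (hf' : EveAction.resp f ∈ A.epiAllowE (A.trackState G ζ h))
    (hs : (A.trackState G ζ h).IsSpread G) {t : Situation Agt}
    (ht : t ∈ (A.trackState G ζ h).sits) {m : Agt → Act} (hm : f t.dev = some m)
    {a : Agt} (hbel : A.belief G ζ h a = some t.dev ∨ A.belief G ζ h a = none ∧ a ∉ t.I) :
    (A.toProfile G ζ a h).1 = m a := by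
  obtain ⟨-, hdom, hall, heq⟩ := hf'
  have : suggestion (A.trackState G ζ h) a (A.belief G ζ h a) (EveAction.resp f) =
      some (m a) := by
    obtain hbel | ⟨hbel, ha⟩ := hbel
    · simp [suggestion, hbel, hm]
    · obtain ⟨t', hp, ht', ha'⟩ := exists_pickWhere_eq_some
        (p := fun t : Situation Agt => t ∈ (A.trackState G ζ h).sits ∧ a ∉ t.I) ⟨t, ht, ha⟩
      obtain ⟨m', hm'⟩ := Option.isSome_iff_exists.1 ((hdom t'.dev).2 ⟨t', ht', rfl⟩)
      have hu : a ∉ t'.I ∪ t.I := by simp [ha, ha']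
      simp only [suggestion, hbel, hp, Option.orElse_none, Option.map_some, Option.bind_some, hm']
      rw [heq t' ht' t ht a hu (hs.K_eq_K ht' ht hu) m' m hm' hm]
  simp only [toProfile, hf, this]
  exact A.makeAllowed_some (hall _ _ hm a)

/-- One round with `d` as the only possible deviator keeps her among the suspects, and makes the
players who believe in `d` exactly those in the new `I_d`. -/
theorem Tracks.cons (hζ : (A.epistemicGame G).IsEveStrategy ζ) {d : Agt}
    {h : FullHist V Act Agt} (ht : A.Tracks G ζ d h) {m : Agt → Act} {c : Messages Agt}
    (hmd : m d ∈ A.allow (A.last h) d) (hm : ∀ a ≠ d, m a = (A.toProfile G ζ a h).1)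
    (hc : ∀ a ≠ d, c a = (A.toProfile G ζ a h).2) :
    A.Tracks G ζ d ((m, c, A.tab (A.last h) m) :: h) := by
  have hall : ∀ a, m a ∈ A.allow (A.last h) a := fun a => by
    by_cases ha : a = d
    · exact ha ▸ hmd
    · rw [hm a ha]
      exact A.isStrategy_toProfile G ζ a h ht.isHist
  have hvtx := A.vtx_trackState G ζ h
  have hact := A.trackAct_mem G hζ ht.isHist_track
  have hspread : (A.trackState G ζ h).IsSpread G := A.isSpread_last G ht.isHist_track
  have hupd : ∀ m' : Agt → Act, (∀ a ≠ d, m a = m' a) → Function.update m' d (m d) = m :=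
    fun m' hm' => by
      funext a
      by_cases ha : a = d
      · subst ha; simp
      · simp [ha, hm' a ha]
  by_cases hs : (A.trackState G ζ h).sits = ∅
  · obtain ⟨m₀, hm₀⟩ := exists_move_of_sits_eq_empty hact hs
    have hall₀ : ∀ a, m₀ a ∈ A.allow (A.trackState G ζ h).vtx a := by
      rw [hm₀] at hact
      exact hact.2
    have hmm : ∀ a ≠ d, m a = m₀ a := fun a ha => by
      rw [hm a ha, toProfile_of_move hm₀ hall₀]
    have hreach : A.CanReach (A.trackState G ζ h).vtx m₀ d (A.tab (A.last h) m) :=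
      ⟨m d, hvtx ▸ hmd, by rw [hupd m₀ hmm, hvtx]⟩
    refine ⟨⟨ht.isHist, hall, rfl⟩, A.isHist_track_cons G hζ ht.isHist_track ?_, fun hne => ?_⟩
    · rw [hm₀]
      exact ⟨d, hreach⟩
    · rw [trackState_cons, hm₀] at hne ⊢
      obtain ⟨u, hu⟩ := Set.nonempty_iff_ne_empty.2 hne
      have hne' : A.tab (A.trackState G ζ h).vtx m₀ ≠ A.tab (A.last h) m := hu.1
      obtain ⟨t, htm, rfl⟩ := A.exists_mem_updateFirst G hne' hreach
      have hmd' : m t.dev ≠ m₀ t.dev := fun he => hne' <| by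
        rw [hvtx]
        congr 1
        rw [← hupd m₀ hmm, he, Function.update_eq_self]
      refine ⟨t, htm, rfl, fun a ha => ?_, fun a ha => ?_⟩ <;> rw [htm.2.2.1] at ha
      -- The chosen `b` departs from Eve's move `m₀`, and only the deviator does so.
      · obtain ⟨b, hb, -, -, hb'⟩ := exists_pickWhere_eq_some
          (p := fun b => A.tab (A.trackState G ζ h).vtx m₀ ≠ A.tab (A.last h) m ∧ Hears G b a ∧
            m b ≠ m₀ b) ⟨t.dev, hne', ha, hmd'⟩
        simp only [Arena.belief, hm₀, beliefStep, hb]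
        by_contra hbd
        exact hb' (hmm b fun he => hbd (he ▸ rfl))
      · simp only [Arena.belief, hm₀, beliefStep]
        refine pickWhere_eq_none ?_
        rintro b ⟨-, hba, hb'⟩
        obtain rfl : b = t.dev := by
          by_contra hbd
          exact hb' (hmm b hbd)
        exact ha hba
  · obtain ⟨u, hu, rfl, hI, hI'⟩ := ht.belief hs
    obtain ⟨f, hf⟩ := exists_resp_of_sits_ne_empty hact hs
    rw [hf] at hact
    obtain ⟨m₀, hm₀⟩ := Option.isSome_iff_exists.1 ((hact.2.1 u.dev).2 ⟨u, hu, rfl⟩)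
    have hmm : ∀ a ≠ u.dev, m a = m₀ a := fun a ha => by
      rw [hm a ha]
      refine toProfile_of_resp hf hact hspread hu hm₀ ?_
      by_cases hau : a ∈ u.I
      · exact .inl (hI a hau)
      · exact .inr ⟨hI' a hau, hau⟩
    have hreach : A.CanReach (A.trackState G ζ h).vtx m₀ u.dev (A.tab (A.last h) m) :=
      ⟨m u.dev, hvtx ▸ hmd, by rw [hupd m₀ hmm, hvtx]⟩
    obtain ⟨t, htm, htd, htI⟩ := A.exists_mem_updateNext G hu hm₀ hreach
    refine ⟨⟨ht.isHist, hall, rfl⟩, A.isHist_track_cons G hζ ht.isHist_track ?_, fun _ => ?_⟩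
    · rw [hf]
      exact ⟨u.dev, ⟨u, hu, rfl⟩, m₀, hm₀, hreach⟩
    · rw [trackState_cons, hf]
      -- Whoever a still uninformed player hears is not the deviator, hence reports her belief
      -- honestly.
      have hcode : ∀ b a, Hears G b a → a ∉ u.I →
          decodeMsg (c b) = A.belief G ζ h b := fun b a hba ha => by
        rw [hc b fun he => ha (hspread.mem_I_of_hears hu (he ▸ hba)), toProfile,
          decodeMsg_encodeMsg]
      refine ⟨t, htm, htd, fun a ha => ?_, fun a ha => ?_⟩ <;> rw [htI] at ha <;>
        simp only [Arena.belief, hf, beliefStep]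
      · by_cases hau : a ∈ u.I
        · simp [hI a hau]
        · obtain ⟨b, hb, hba⟩ := ha.resolve_left hau
          obtain ⟨b', hb', hba', hsome⟩ := exists_pickWhere_eq_some
            (p := fun b => Hears G b a ∧ (decodeMsg (Agt := Agt) (c b)).isSome)
            ⟨b, hba, by rw [hcode b a hba hau, hI b hb]; rfl⟩
          -- Whichever sender `b'` was picked, a meaningful honest word comes from an informed
          -- player, and all of these name the true deviator.
          rw [hI' a hau, hb']
          rw [hcode b' a hba' hau] at hsome
          have hbu : b' ∈ u.I := by
            by_contra hn
            simp [hI' b' hn] at hsome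
          simp [hcode b' a hba' hau, hI b' hbu]
      · rw [Set.mem_union, not_or] at ha
        rw [hI' a ha.1, pickWhere_eq_none]
        · rfl
        · rintro b ⟨hba, hsome⟩
          rw [hcode b a hba ha.1, hI' b fun hb => ha.2 ⟨b, hb, hba⟩] at hsome
          simp at hsome

theorem tracks_out (hζ : (A.epistemicGame G).IsEveStrategy ζ) {d : Agt}
    {σ' : FullHist V Act Agt → Act × List Bool} (hσ' : A.IsStrategy d σ') (n : ℕ) :
    A.Tracks G ζ d (A.out (Function.update (A.toProfile G ζ) d σ') n) := by
  induction n with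
  | zero => exact A.tracks_nil G ζ d
  | succ n ih =>
    refine ih.cons hζ ?_ (fun a ha => ?_) fun a ha => ?_
    · simpa using hσ' _ ih.isHist
    · simp [ha]
    · simp [ha]

theorem complies_trackPlay_toProfile (hζ : (A.epistemicGame G).IsEveStrategy ζ) :
    (A.epistemicGame G).IsOutcome ζ (A.trackPlay G ζ (A.toProfile G ζ)) ∧
      A.Complies (A.trackPlay G ζ (A.toProfile G ζ)) := by
  obtain ⟨d⟩ := ‹Nonempty Agt›
  -- The profile itself counts as a deviation of `d` to her own strategy.
  have ht := fun n => tracks_out hζ (A.isStrategy_toProfile G ζ d) n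
  rw [Function.update_eq_self] at ht
  refine ⟨A.isOutcome_trackPlay G ζ fun n => (ht n).isHist_track, fun n m hm => ?_⟩
  have hm : A.trackAct G ζ (A.out (A.toProfile G ζ) n) = .move m := hm
  have hact := A.trackAct_mem G hζ (ht n).isHist_track
  rw [hm] at hact
  simp only [trackPlay, vtx_trackState, out, last]
  congr 1
  funext a
  exact toProfile_of_move hm hact.2 a

theorem isNash_toProfile {payoff : Agt → (ℕ → V) → EReal} {p : Agt → EReal}
    (hw : (ConcurrentGame.mk A payoff).EveWins G ζ p) :
    (ConcurrentGame.mk A payoff).IsNash G (A.toProfile G ζ) ∧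
      (ConcurrentGame.mk A payoff).HasPayoff (A.toProfile G ζ) p := by
  obtain ⟨hζ, R, hR, hc, hp, hdev⟩ := hw
  obtain ⟨hR₀, hc₀⟩ := complies_trackPlay_toProfile hζ
  have hpay : ∀ a, payoff a (A.outVertices (A.toProfile G ζ)) = p a := fun a => by
    rw [← A.visited_trackPlay G ζ, eq_of_complies hζ hR₀ hR hc₀ hc]
    exact hp a
  refine ⟨⟨fun a => ⟨A.isStrategy_toProfile G ζ a, A.isCompatible_toProfile G ζ a⟩,
    fun d σ' hσ' _ => ?_⟩, hpay⟩
  have ht := fun n => tracks_out hζ hσ' n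
  have hR' := A.isOutcome_trackPlay G ζ fun n => (ht n).isHist_track
  show ¬ payoff d _ < payoff d (A.outVertices (Function.update (A.toProfile G ζ) d σ'))
  rw [hpay, not_lt, ← A.visited_trackPlay G ζ]
  -- A deviation may leave all vertices unchanged; then the play is the compliant one, with payoff
  -- exactly `p d`. Otherwise a situation arises, and from then on `d` is always a suspect.
  by_cases he : A.trackPlay G ζ (Function.update (A.toProfile G ζ) d σ') = R
  · rw [he]
    exact (hp d).le
  · refine hdev _ hR' he d ?_
    have hnc : ¬ ∀ n, ((A.trackPlay G ζ (Function.update (A.toProfile G ζ) d σ')).eve n).sits = ∅ :=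
      fun hall => he (eq_of_complies hζ hR' hR ((complies_iff hζ hR').2 hall) hc)
    push Not at hnc
    obtain ⟨N, hN⟩ := hnc
    refine Filter.eventually_atTop.2 ⟨N, fun n hn => ?_⟩
    have hne : ((A.trackPlay G ζ (Function.update (A.toProfile G ζ) d σ')).eve n).sits ≠ ∅ := by
      induction n, hn using Nat.le_induction with
      | base => exact hN.ne_empty
      | succ n _ ih => exact (devs_succ_subset hζ hR' ih).1
    obtain ⟨t, ht, htd, -⟩ := (ht n).belief hne
    exact ⟨t, ht, htd⟩

end Profile

end Arena

namespace Arena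

/-! ### Effectiveness of the map to profiles. -/

section Effective

variable {V Act Agt : Type*} [DecidableEq Agt] {A : Arena V Act Agt} {G : Digraph Agt}
  [Nonempty Agt]

theorem last_eq_elim_head? (H : EpiHist V Act Agt) : (A.epistemicGame G).last H =
    H.head?.elim (A.epistemicGame G).init Prod.snd := by
  cases H <;> rfl

theorem effectiveToProfile_toProfile [Finite V] [Finite Act] [Finite Agt] :
    EffectiveToProfile (A.toProfile G) := by
  unfold EffectiveToProfile
  let _ := fullHistCoding V Act Agt
  let _ := decisionCoding Act Agt
  let _ := epiHistCoding V Act Agt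
  let _ := finiteCoding (EveAction Act Agt)
  let _ := finiteCoding (Agt → Option Agt)
  let _ := finiteCoding V
  let _ := finiteCoding (Agt → Act)
  let _ := tupleCoding Agt (List Bool)
  let _ := finiteCoding Agt
  let _ := finiteCoding (AdamState V Act Agt × EveState V Agt)
  let S := EpiHist V Act Agt × (Agt → Option Agt)
  let X := (Agt → Act) × Messages Agt × V
  let st : Option (AdamState V Act Agt × EveState V Agt) → EveState V Agt :=
    fun o => o.elim (A.epistemicGame G).init Prod.snd
  let step : (S × EveAction Act Agt) × X → S := fun z =>
    let s := st z.1.1.1.head?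
    (((s, z.1.2), A.epiTabA G (s, z.1.2) z.2.2.2) :: z.1.1.1,
      A.beliefStep G s z.1.2 z.1.1.2 z.2.1 (fun b => decodeMsg (z.2.2.1 b)) z.2.2.2)
  let out : (FullHist V Act Agt × S) × EveAction Act Agt → Agt → Act × List Bool := fun z a =>
    (A.makeAllowed (st z.1.2.1.head?).vtx a
      (suggestion (st z.1.2.1.head?) a (z.1.2.2 a) z.2), encodeMsg (z.1.2.2 a))
  -- Histories store the latest step first, so the run goes along the reversed list. Its state is
  -- the tracked history with the beliefs, and the query is the tracked history.
  refine effective_of_fold (S := S) (X := X) (xs := List.reverse) ([], fun _ => none)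
    (q := Prod.fst) (step := step) (out := out) Primrec.list_reverse Primrec.fst ?_ ?_ ?_
  · have hH : Primrec fun z : (S × EveAction Act Agt) × X => z.1.1.1 :=
      Primrec.fst.comp (Primrec.fst.comp Primrec.fst)
    have hcode : Primrec fun z : (S × EveAction Act Agt) × X =>
        (fun b => decodeMsg (z.2.2.1 b) : Agt → Option Agt) :=
      (primrec_tupleCoding_map_finite primrec_decodeMsg).comp
        (Primrec.fst.comp (Primrec.snd.comp Primrec.snd))
    -- Once messages are decoded and the tracked history is replaced by its head, everything that a
    -- step needs ranges over a finite type, where every function is primitive recursive.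
    have hdata := ((Primrec.list_head?.comp hH).pair (Primrec.snd.comp Primrec.fst)).pair
      (((Primrec.snd.comp (Primrec.fst.comp Primrec.fst)).pair (Primrec.fst.comp Primrec.snd)).pair
      (hcode.pair (Primrec.snd.comp (Primrec.snd.comp Primrec.snd))))
    refine Primrec.pair (Primrec.list_cons.comp ((Primrec.dom_finite (fun
        y : (Option (AdamState V Act Agt × EveState V Agt) × EveAction Act Agt) ×
          ((Agt → Option Agt) × (Agt → Act)) × (Agt → Option Agt) × V =>
        ((st y.1.1, y.1.2), A.epiTabA G (st y.1.1, y.1.2) y.2.2.2))).comp hdata) hH)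
      ((Primrec.dom_finite (fun
        y : (Option (AdamState V Act Agt × EveState V Agt) × EveAction Act Agt) ×
          ((Agt → Option Agt) × (Agt → Act)) × (Agt → Option Agt) × V =>
        A.beliefStep G (st y.1.1) y.1.2 y.2.1.1 y.2.1.2 y.2.2.1 y.2.2.2)).comp hdata)
  · have hH : Primrec fun z : (FullHist V Act Agt × S) × EveAction Act Agt => z.1.2.1 :=
      Primrec.fst.comp (Primrec.snd.comp Primrec.fst)
    exact (Primrec.dom_finite (fun
        y : (Option (AdamState V Act Agt × EveState V Agt) × (Agt → Option Agt)) ×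
          EveAction Act Agt => fun a => (A.makeAllowed (st y.1.1).vtx a
            (suggestion (st y.1.1) a (y.1.2 a) y.2), encodeMsg (y.1.2 a)))).comp
      (((Primrec.list_head?.comp hH).pair (Primrec.snd.comp (Primrec.snd.comp Primrec.fst))).pair
        Primrec.snd)
  · have key : ∀ ζ h, oracleFold Prod.fst step ζ (([], fun _ => none) : S) (List.reverse h) =
        (A.track G ζ h, A.belief G ζ h) := by
      intro ζ h
      induction h with
      | nil => rfl
      | cons x h ih =>
        simp only [oracleFold] at ih
        simp only [oracleFold, List.reverse_cons, List.foldl_append, ih, List.foldl_cons,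
          List.foldl_nil, step, st, track, belief, trackState, trackAct, last_eq_elim_head?]
    intro ζ h
    rw [key]
    simp only [out, st, toProfile, trackState, trackAct, last_eq_elim_head?]

end Effective

end Arena

/-! ### From strategy profiles to strategies of Eve -/

namespace Arena

/-! ### Views of a player and realisation of deviations. -/

section Projection

variable {V Act Agt : Type*} {A : Arena V Act Agt} {G : Digraph Agt}

theorem proj_cons_eq {a : Agt} {m m' : Agt → Act} {c c' : Messages Agt} {v : V}
    {h h' : FullHist V Act Agt} (hm : ∀ b, Hears G b a → m b = m' b)
    (hc : ∀ b, Hears G b a → c b = c' b) (hp : proj G a h = proj G a h') :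
    proj G a ((m, c, v) :: h) = proj G a ((m', c', v) :: h') := by
  simp only [proj, List.map_cons, List.cons.injEq, Prod.mk.injEq, and_true]
  exact ⟨⟨funext fun b => hm b b.2, funext fun b => hc b b.2⟩, hp⟩

theorem proj_length {a : Agt} {h h' : FullHist V Act Agt} (hp : proj G a h = proj G a h') :
    h.length = h'.length := by
  simpa [proj] using congrArg List.length hp

theorem last_eq_of_proj_eq {a : Agt} {h h' : FullHist V Act Agt} (hp : proj G a h = proj G a h') :
    A.last h = A.last h' := by
  obtain _ | ⟨x, h⟩ := h <;> obtain _ | ⟨y, h'⟩ := h'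
  · rfl
  · simp [proj] at hp
  · simp [proj] at hp
  · simp only [proj, List.map_cons, List.cons.injEq, Prod.mk.injEq] at hp
    exact hp.1.2.2

/-- A sequence of histories in which only `d` deviates from `σ`, and only by her actions, is the
outcome of a compatible deviation of `d`. -/
theorem exists_deviation [DecidableEq Agt] {σ : Profile V Act Agt} {d : Agt}
    (hσ : A.IsStrategy d (σ d) ∧ A.IsCompatible G d (σ d))
    {g : ℕ → FullHist V Act Agt} {m : ℕ → Agt → Act} (h0 : g 0 = [])
    (hg : ∀ n, A.IsHist (g n))
    (hsucc : ∀ n, g (n + 1) =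
      (m n, fun a => (σ a (g n)).2, A.tab (A.last (g n)) (m n)) :: g n)
    (hm : ∀ n, ∀ a ≠ d, m n a = (σ a (g n)).1) :
    ∃ σ', A.IsStrategy d σ' ∧ A.IsCompatible G d σ' ∧
      ∀ n, A.out (Function.update σ d σ') n = g n := by
  classical
  have hlen : ∀ n, (g n).length = n := fun n => by
    induction n with
    | zero => simp [h0]
    | succ n ih => simp [hsucc, ih]
  -- The deviation takes its action from `m` as long as what `d` sees agrees with `g` at the same
  -- time. Testing only her view and the length makes it compatible.
  refine ⟨fun h => if proj G d h = proj G d (g h.length) then (m h.length d, (σ d h).2)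
    else σ d h, fun h hh => ?_, fun h h' hh hh' hp => ?_, fun n => ?_⟩
  · dsimp only
    split_ifs with hp
    · rw [last_eq_of_proj_eq hp]
      have := hg (h.length + 1)
      rw [hsucc] at this
      exact this.2.1 d
    · exact hσ.1 h hh
  · dsimp only
    rw [proj_length hp, hp, hσ.2 h h' hh hh' hp]
  · induction n with
    | zero => exact h0.symm
    | succ n ih =>
      rw [out, ih, hsucc]
      have h1 : (fun a => (Function.update σ d (fun h => if proj G d h = proj G d (g h.length)
          then (m h.length d, (σ d h).2) else σ d h) a (g n)).1) = m n := by
        funext a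
        by_cases ha : a = d
        · subst ha
          simp [hlen]
        · simp [ha, hm n a ha]
      have h2 : (fun a => (Function.update σ d (fun h => if proj G d h = proj G d (g h.length)
          then (m h.length d, (σ d h).2) else σ d h) a (g n)).2) = fun a => (σ a (g n)).2 := by
        funext a
        by_cases ha : a = d
        · subst ha
          simp [hlen]
        · simp [ha]
      rw [h1, h2]

end Projection

/-! ### Eve's strategy built from an equilibrium. -/

section ToEve

variable {V Act Agt : Type*} [DecidableEq Agt] (A : Arena V Act Agt) (G : Digraph Agt)

open Classical in
/-- The move `m` with the action of `d` changed so that the game proceeds from `v` to `v'`, if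
this is possible. -/
noncomputable def redirect (v : V) (m : Agt → Act) (d : Agt) (v' : V) : Agt → Act :=
  if h : A.CanReach v m d v' then Function.update m d h.choose else m

theorem redirect_of_ne {v : V} {m : Agt → Act} {d : Agt} {v' : V} {a : Agt} (ha : a ≠ d) :
    A.redirect v m d v' a = m a := by
  unfold redirect
  split_ifs
  · simp [ha]
  · rfl

theorem redirect_mem {v : V} {m : Agt → Act} {d : Agt} {v' : V}
    (hm : ∀ a, m a ∈ A.allow v a) (a : Agt) : A.redirect v m d v' a ∈ A.allow v a := by
  unfold redirect
  split_ifs with h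
  · by_cases ha : a = d
    · subst ha
      simpa using h.choose_spec.1
    · simpa [ha] using hm a
  · exact hm a

theorem tab_redirect {v : V} {m : Agt → Act} {d : Agt} {v' : V} (h : A.CanReach v m d v') :
    A.tab v (A.redirect v m d v') = v' := by
  unfold redirect
  rw [dif_pos h]
  exact h.choose_spec.2

open Classical in
/-- The move behind a round of the epistemic game if `d` is the deviator. -/
noncomputable def roundMove (x : AdamState V Act Agt × EveState V Agt) (d : Agt) : Agt → Act :=
  match x.1.2 with
  | .move m => if x.2.vtx = A.tab x.1.1.vtx m then m else A.redirect x.1.1.vtx m d x.2.vtx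
  | .resp f => A.redirect x.1.1.vtx ((f d).getD fun a => (A.allow_nonempty x.1.1.vtx a).some) d
      x.2.vtx

theorem roundMove_resp {s s' : EveState V Agt} {f : Agt → Option (Agt → Act)} {d : Agt}
    {m : Agt → Act} (hm : f d = some m) :
    A.roundMove ((s, .resp f), s') d = A.redirect s.vtx m d s'.vtx := by
  simp [roundMove, hm]

theorem roundMove_move_of_ne {s s' : EveState V Agt} {m : Agt → Act} {d a : Agt} (ha : a ≠ d) :
    A.roundMove ((s, .move m), s') d a = m a := by
  simp only [roundMove]
  split_ifs
  · rfl
  · exact A.redirect_of_ne ha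

/-- Here the move does not depend on `d`, even if she has another action leading to the same vertex;
so all simulations coincide until Adam stops complying. -/
theorem roundMove_move_of_eq {s s' : EveState V Agt} {m : Agt → Act} {d : Agt}
    (h : s'.vtx = A.tab s.vtx m) : A.roundMove ((s, .move m), s') d = m := by
  simp [roundMove, h]

theorem roundMove_move_mem {s s' : EveState V Agt} {m : Agt → Act} {d : Agt}
    (hm : ∀ a, m a ∈ A.allow s.vtx a) (a : Agt) :
    A.roundMove ((s, .move m), s') d a ∈ A.allow s.vtx a := by
  simp only [roundMove]
  split_ifs
  · exact hm a
  · exact A.redirect_mem hm a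

theorem tab_roundMove_move {s s' : EveState V Agt} {m : Agt → Act} {d : Agt}
    (h : A.CanReach s.vtx m d s'.vtx) :
    A.tab s.vtx (A.roundMove ((s, .move m), s') d) = s'.vtx := by
  simp only [roundMove]
  split_ifs with h'
  · exact h'.symm
  · exact A.tab_redirect h

/-- The full history behind a history of the epistemic game if `d` is the deviator: all the
messages are those of `σ`. -/
noncomputable def simulate (σ : Profile V Act Agt) (d : Agt) : EpiHist V Act Agt → FullHist V Act Agt
  | [] => []
  | x :: H => (A.roundMove x d, fun a => (σ a (simulate σ d H)).2, x.2.vtx) :: simulate σ d H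

variable [Nonempty Agt]

open Classical in
/-- The strategy of Eve that reads off the moves from the profile `σ`. -/
noncomputable def toEve (σ : Profile V Act Agt) (H : EpiHist V Act Agt) : EveAction Act Agt :=
  if ((A.epistemicGame G).last H).sits = ∅ then
    .move fun a => (σ a (A.simulate σ (Classical.arbitrary Agt) H)).1
  else
    .resp fun d => if d ∈ ((A.epistemicGame G).last H).devs then
      some fun a => (σ a (A.simulate σ d H)).1 else none

theorem last_simulate (σ : Profile V Act Agt) (d : Agt) (H : EpiHist V Act Agt) :
    A.last (A.simulate σ d H) = ((A.epistemicGame G).last H).vtx := by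
  cases H <;> rfl

variable {A G} {σ : Profile V Act Agt}

/-- What the simulated histories have in common. -/
structure SimulationSpec (A : Arena V Act Agt) (G : Digraph Agt) (σ : Profile V Act Agt)
    (H : EpiHist V Act Agt) : Prop where
  eq : ((A.epistemicGame G).last H).sits = ∅ → ∀ d d', A.simulate σ d H = A.simulate σ d' H
  isHist : ∀ d, ((A.epistemicGame G).last H).sits = ∅ ∨ d ∈ ((A.epistemicGame G).last H).devs →
    A.IsHist (A.simulate σ d H)
  proj_eq : ∀ t ∈ ((A.epistemicGame G).last H).sits, ∀ t' ∈ ((A.epistemicGame G).last H).sits,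
    ∀ a ∉ t.I ∪ t'.I, proj G a (A.simulate σ t.dev H) = proj G a (A.simulate σ t'.dev H)

/-- The core is `proj_eq`. If `a` is now informed in neither situation, then so were all players
heard by `a` one round earlier. Their actions agree because Eve's response, here any legal one,
satisfies her constraint; their messages agree because they had equal views and `σ` is compatible.
-/
theorem simulationSpec (hσ : ∀ a, A.IsCompatible G a (σ a)) {H : EpiHist V Act Agt}
    (hH : (A.epistemicGame G).IsHist H) : SimulationSpec A G σ H := by
  induction H with
  | nil => exact ⟨fun _ _ _ => rfl, fun _ _ => trivial, fun _ _ _ _ _ _ => rfl⟩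
  | cons x H ih =>
    obtain ⟨x, s'⟩ := x
    have hspread := A.isSpread_last G hH.1
    obtain ⟨hH, ⟨f, hf, rfl⟩, v', hv', rfl⟩ := hH
    have ih := ih hH
    have hlast := fun d => A.last_simulate G σ d H
    set s := (A.epistemicGame G).last H with hs
    change f ∈ A.epiAllowE s at hf
    change v' ∈ A.epiAllowA (s, f) at hv'
    have hl : (A.epistemicGame G).last
        (((A.epistemicGame G).tabE s f, (A.epistemicGame G).tabA ((A.epistemicGame G).tabE s f) v')
          :: H) = A.epiTabA G (s, f) v' := rfl
    have hcons : ∀ d, A.simulate σ d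
        (((A.epistemicGame G).tabE s f, (A.epistemicGame G).tabA ((A.epistemicGame G).tabE s f) v')
          :: H) = (A.roundMove ((s, f), A.epiTabA G (s, f) v') d,
            fun a => (σ a (A.simulate σ d H)).2, v') :: A.simulate σ d H := fun d => by
      have h := A.vtx_epiTabA G (s, f) v'
      conv_rhs => enter [1, 2, 2]; rw [← h]
      rfl
    refine ⟨?_, ?_, ?_⟩ <;> simp only [hl, hcons]
    · intro hempty d d'
      cases f with
      | resp f => exact absurd hempty (A.sits_epiTabA_resp_nonempty G hv').ne_empty
      | move m =>
        rw [A.sits_epiTabA_move_eq_empty_iff G hv'] at hempty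
        have hvtx : (A.epiTabA G (s, .move m) v').vtx = A.tab s.vtx m := by simpa using hempty
        rw [A.roundMove_move_of_eq hvtx, A.roundMove_move_of_eq hvtx, ih.eq hf.1 d d']
    · intro d hd
      cases f with
      | move m =>
        have hreach : A.CanReach s.vtx m d v' := by
          obtain hempty | ⟨t, ht, rfl⟩ := hd
          · rw [A.sits_epiTabA_move_eq_empty_iff G hv'] at hempty
            exact ⟨m d, hf.2 d, by rw [Function.update_eq_self, hempty]⟩
          · exact ht.2.1
        refine ⟨ih.isHist d (.inl hf.1), ?_, ?_⟩ <;> rw [hlast d]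
        · exact A.roundMove_move_mem hf.2
        · rw [A.tab_roundMove_move (by simpa using hreach), vtx_epiTabA]
      | resp f =>
        obtain ⟨t, ht, rfl⟩ :=
          hd.resolve_left (A.sits_epiTabA_resp_nonempty G hv').ne_empty
        obtain ⟨u, hu, hdu, ⟨m, hm, hr⟩, -⟩ := ht
        rw [hdu]
        refine ⟨ih.isHist u.dev (.inr ⟨u, hu, rfl⟩), ?_, ?_⟩ <;>
          rw [hlast, A.roundMove_resp hm, vtx_epiTabA]
        · exact A.redirect_mem (hf.2.2.1 _ _ hm)
        · exact (A.tab_redirect hr).symm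
    · intro t ht t' ht' a ha
      rw [Set.mem_union, not_or] at ha
      cases f with
      | move m =>
        rw [ht.2.2.1, ht'.2.2.1] at ha
        rw [ih.eq hf.1 t.dev t'.dev]
        refine proj_cons_eq (fun b hb => ?_) (fun _ _ => rfl) rfl
        rw [A.roundMove_move_of_ne (show b ≠ t.dev from fun he => ha.1 (he ▸ hb)),
          A.roundMove_move_of_ne (show b ≠ t'.dev from fun he => ha.2 (he ▸ hb))]
      | resp f =>
        obtain ⟨u, hu, hdu, ⟨m, hm, -⟩, hI, -⟩ := ht
        obtain ⟨u', hu', hdu', ⟨m', hm', -⟩, hI', -⟩ := ht'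
        rw [hI, hI', Set.mem_union, Set.mem_union, not_or, not_or] at ha
        rw [hdu, hdu']
        -- An informed `b` would have informed `a` in this round. In particular `b` is not the
        -- deviator, so redirecting does not touch the action of `b`.
        have hb₁ : ∀ b, Hears G b a → b ∉ u.I := fun b hb hbu => ha.1.2 ⟨b, hbu, hb⟩
        have hb₂ : ∀ b, Hears G b a → b ∉ u'.I := fun b hb hbu => ha.2.2 ⟨b, hbu, hb⟩
        have hb : ∀ b, Hears G b a → b ∉ u.I ∪ u'.I := fun b hb => by
          simp [hb₁ b hb, hb₂ b hb]
        refine proj_cons_eq (fun b hba => ?_) (fun b hba => ?_)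
          (ih.proj_eq u hu u' hu' a (hb a (.inr rfl)))
        · rw [A.roundMove_resp hm, A.roundMove_resp hm',
            A.redirect_of_ne (show b ≠ u.dev from fun he => hb₁ b hba (he ▸ u.dev_mem)),
            A.redirect_of_ne (show b ≠ u'.dev from fun he => hb₂ b hba (he ▸ u'.dev_mem))]
          exact hf.2.2.2 u hu u' hu' b (hb b hba) (hspread.K_eq_K hu hu' (hb b hba)) m m' hm hm'
        · rw [hσ b _ _ (ih.isHist _ (.inr ⟨u, hu, rfl⟩)) (ih.isHist _ (.inr ⟨u', hu', rfl⟩))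
            (ih.proj_eq u hu u' hu' b (hb b hba))]

/-- Eve's constraint holds since equal views (`SimulationSpec.proj_eq`) force equal actions under a
compatible profile. -/
theorem isEveStrategy_toEve (hσ : ∀ a, A.IsStrategy a (σ a) ∧ A.IsCompatible G a (σ a)) :
    (A.epistemicGame G).IsEveStrategy (A.toEve G σ) := by
  intro H hH
  have spec := simulationSpec (fun a => (hσ a).2) hH
  unfold toEve
  split_ifs with hs
  · refine ⟨hs, fun a => ?_⟩
    rw [← A.last_simulate G σ (Classical.arbitrary Agt) H]
    exact (hσ a).1 _ (spec.isHist _ (.inl hs))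
  · refine ⟨hs, fun d => ?_, fun d m hm a => ?_, fun t ht t' ht' a ha _ m m' hm hm' => ?_⟩
    · by_cases hd : d ∈ ((A.epistemicGame G).last H).devs <;> simp [hd]
    · by_cases hd : d ∈ ((A.epistemicGame G).last H).devs
      · simp only [hd, if_true, Option.some.injEq] at hm
        rw [← A.last_simulate G σ d H, ← hm]
        exact (hσ a).1 _ (spec.isHist _ (.inr hd))
      · simp [hd] at hm
    · have hd : t.dev ∈ ((A.epistemicGame G).last H).devs := ⟨t, ht, rfl⟩
      have hd' : t'.dev ∈ ((A.epistemicGame G).last H).devs := ⟨t', ht', rfl⟩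
      simp only [hd, hd', if_true, Option.some.injEq] at hm hm'
      subst hm hm'
      dsimp only
      rw [(hσ a).2 _ _ (spec.isHist _ (.inr hd)) (spec.isHist _ (.inr hd'))
        (spec.proj_eq t ht t' ht' a ha)]

theorem toEve_of_empty (hσ : ∀ a, A.IsCompatible G a (σ a)) {H : EpiHist V Act Agt}
    (hH : (A.epistemicGame G).IsHist H) (hs : ((A.epistemicGame G).last H).sits = ∅) (d : Agt) :
    A.toEve G σ H = .move fun a => (σ a (A.simulate σ d H)).1 := by
  rw [toEve, if_pos hs, (simulationSpec hσ hH).eq hs _ d]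

theorem toEve_of_ne_empty {H : EpiHist V Act Agt}
    (hs : ((A.epistemicGame G).last H).sits ≠ ∅) : ∃ f, A.toEve G σ H = .resp f ∧
      ∀ d ∈ ((A.epistemicGame G).last H).devs,
        f d = some fun a => (σ a (A.simulate σ d H)).1 := by
  rw [toEve, if_neg hs]
  exact ⟨_, rfl, fun d hd => if_pos hd⟩

/-- When Eve plays `toEve`, the players other than the deviator play according to `σ`. -/
theorem roundMove_toEve (hσ : ∀ a, A.IsCompatible G a (σ a)) {H : EpiHist V Act Agt}
    (hH : (A.epistemicGame G).IsHist H) {d : Agt}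
    (hd : ((A.epistemicGame G).last H).sits = ∅ ∨ d ∈ ((A.epistemicGame G).last H).devs)
    (s' : EveState V Agt) {a : Agt} (ha : a ≠ d) :
    A.roundMove (((A.epistemicGame G).last H, A.toEve G σ H), s') d a =
      (σ a (A.simulate σ d H)).1 := by
  by_cases hs : ((A.epistemicGame G).last H).sits = ∅
  · rw [toEve_of_empty hσ hH hs d, A.roundMove_move_of_ne ha]
  · obtain ⟨f, hf, hfd⟩ := toEve_of_ne_empty (σ := σ) hs
    rw [hf, A.roundMove_resp (hfd d (hd.resolve_left hs)), A.redirect_of_ne ha]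

/-- Along the outcome of `σ`, Eve suggests the move of `σ` and the next vertex obeys it, so no
situation arises. This provides the compliant play with the payoff of `σ`. -/
theorem simulate_track_out (hσ : ∀ a, A.IsStrategy a (σ a) ∧ A.IsCompatible G a (σ a)) (n : ℕ) :
    (A.epistemicGame G).IsHist (A.track G (A.toEve G σ) (A.out σ n)) ∧
      (A.trackState G (A.toEve G σ) (A.out σ n)).sits = ∅ ∧
      ∀ d, A.simulate σ d (A.track G (A.toEve G σ) (A.out σ n)) = A.out σ n := by
  induction n with
  | zero => exact ⟨trivial, rfl, fun _ => rfl⟩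
  | succ n ih =>
    obtain ⟨hH, hs, hsim⟩ := ih
    have hζ := isEveStrategy_toEve hσ
    have hact : A.trackAct G (A.toEve G σ) (A.out σ n) =
        .move fun a => (σ a (A.out σ n)).1 := by
      have := toEve_of_empty (fun a => (hσ a).2) hH hs (Classical.arbitrary Agt)
      rwa [hsim] at this
    have hmem := A.trackAct_mem G hζ hH
    rw [hact] at hmem
    have hv' : A.tab (A.last (A.out σ n)) (fun a => (σ a (A.out σ n)).1) ∈
        A.epiAllowA (A.trackState G (A.toEve G σ) (A.out σ n),
          A.trackAct G (A.toEve G σ) (A.out σ n)) := by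
      rw [hact]
      exact ⟨Classical.arbitrary Agt, _, hmem.2 _, by rw [Function.update_eq_self, vtx_trackState]⟩
    refine ⟨A.isHist_track_cons G hζ hH hv', ?_, fun d => ?_⟩
    · rw [out, trackState_cons]
      rw [hact] at hv' ⊢
      rw [A.sits_epiTabA_move_eq_empty_iff G hv', vtx_trackState]
    · have hround : A.roundMove ((A.trackState G (A.toEve G σ) (A.out σ n),
          A.trackAct G (A.toEve G σ) (A.out σ n)),
          A.trackState G (A.toEve G σ) (A.out σ (n + 1))) d =
          fun a => (σ a (A.out σ n)).1 := by
        rw [hact]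
        exact A.roundMove_move_of_eq (by simp [out, last])
      have hcons : A.simulate σ d (A.track G (A.toEve G σ) (A.out σ (n + 1))) =
          (A.roundMove ((A.trackState G (A.toEve G σ) (A.out σ n),
            A.trackAct G (A.toEve G σ) (A.out σ n)),
            A.trackState G (A.toEve G σ) (A.out σ (n + 1))) d,
          fun a => (σ a (A.simulate σ d (A.track G (A.toEve G σ) (A.out σ n)))).2,
          (A.trackState G (A.toEve G σ) (A.out σ (n + 1))).vtx) ::
          A.simulate σ d (A.track G (A.toEve G σ) (A.out σ n)) := rfl
      rw [hcons, hround, hsim d, vtx_trackState]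
      rfl

theorem eveWins_toEve {payoff : Agt → (ℕ → V) → EReal} {p : Agt → EReal}
    (hN : (ConcurrentGame.mk A payoff).IsNash G σ)
    (hp : (ConcurrentGame.mk A payoff).HasPayoff σ p) :
    (ConcurrentGame.mk A payoff).EveWins G (A.toEve G σ) p := by
  obtain ⟨hσ, hdev⟩ := hN
  have hσ : ∀ a, A.IsStrategy a (σ a) ∧ A.IsCompatible G a (σ a) := hσ
  have hζ := isEveStrategy_toEve hσ
  have hR := A.isOutcome_trackPlay G (A.toEve G σ) fun n => (simulate_track_out hσ n).1
  refine ⟨hζ, A.trackPlay G (A.toEve G σ) σ, hR,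
    (complies_iff hζ hR).2 fun n => (simulate_track_out hσ n).2.1, fun a => ?_,
    fun R' hR' _ d hd => ?_⟩
  · rw [visited_trackPlay]
    exact hp a
  · have hH := fun n => (A.epistemicGame G).isHist_hist hζ hR' n
    have hlast := fun n => (A.epistemicGame G).last_hist hR' n
    -- Suspects never return once excluded, so `d` is one at every stage with situations and all
    -- simulations for `d` are genuine histories.
    have hd' : ∀ n, ((A.epistemicGame G).last (R'.hist n)).sits = ∅ ∨
        d ∈ ((A.epistemicGame G).last (R'.hist n)).devs := fun n => by
      rw [hlast]
      exact or_iff_not_imp_left.2 (mem_devs_of_mem_limDev hζ hR' hd)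
    have hg := fun n => (simulationSpec (fun a => (hσ a).2) (hH n)).isHist d (hd' n)
    have hvtx : ∀ n, A.last (A.simulate σ d (R'.hist n)) = visited R' n := fun n => by
      rw [A.last_simulate G, hlast]
      rfl
    obtain ⟨σ', hs', hc', hout⟩ := exists_deviation (G := G) (σ := σ) (hσ d)
      (g := fun n => A.simulate σ d (R'.hist n))
      (m := fun n => A.roundMove (R'.adam n, R'.eve (n + 1)) d) rfl hg
      (fun n => by
        have := hg (n + 1)
        simp only [Play.hist, simulate] at this ⊢
        rw [← this.2.2])
      fun n a ha => by
        have := roundMove_toEve (fun a => (hσ a).2) (hH n) (hd' n) (R'.eve (n + 1)) ha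
        rwa [hlast, ← (eve_succ hR' n).1] at this
    have hle := hdev d σ' hs' hc'
    have hv : A.outVertices (Function.update σ d σ') = visited R' :=
      funext fun n => by rw [outVertices, hout, hvtx]
    have h1 : payoff d (A.outVertices σ) = p d := hp d
    rw [not_lt] at hle
    have hle : payoff d (A.outVertices (Function.update σ d σ')) ≤
      payoff d (A.outVertices σ) := hle
    rwa [hv, h1] at hle

/-- The run has one block of tokens per player `d`. Tokens `some x` rebuild the simulated history
for `d`, with its messages taken from the answers; the closing token `none` stores the actions
answered there in row `d` of a table and clears the history. -/
theorem effectiveToEve_toEve [Finite V] [Finite Act] [Finite Agt] :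
    EffectiveToEve (A.toEve G) := by
  unfold EffectiveToEve
  let _ := fullHistCoding V Act Agt
  let _ := decisionCoding Act Agt
  let _ := epiHistCoding V Act Agt
  let _ := finiteCoding (EveAction Act Agt)
  let _ := finiteCoding V
  let _ := finiteCoding (Agt → Act)
  let _ := finiteCoding (Agt → Agt → Act)
  let _ := tupleCoding Agt (List Bool)
  let _ := finiteCoding Act
  let _ := finiteCoding Agt
  let _ := finiteCoding (AdamState V Act Agt × EveState V Agt)
  let Y := AdamState V Act Agt × EveState V Agt
  let S := FullHist V Act Agt × (Agt → Agt → Act)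
  let R := Agt → Act × List Bool
  let agents : List Agt := List.ofFn (Finite.equivFin Agt).symm
  let block : EpiHist V Act Agt → Agt → List (Agt × Option Y) := fun H d =>
    H.reverse.map (fun x => (d, some x)) ++ [(d, none)]
  let step : (S × R) × (Agt × Option Y) → S := fun z =>
    z.2.2.elim ([], Function.update z.1.1.2 z.2.1 fun a => (z.1.2 a).1) fun y =>
      ((A.roundMove y z.2.1, fun a => (z.1.2 a).2, y.2.vtx) :: z.1.1.1, z.1.1.2)
  -- The initial table is arbitrary, since the block of each player overwrites her row.
  let s₀ : S := ([], fun _ a => (A.allow_nonempty A.init a).some)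
  let st : Option Y → EveState V Agt := fun o => o.elim (A.epistemicGame G).init Prod.snd
  classical
  let eveOut : Option Y × (Agt → Agt → Act) → EveAction Act Agt := fun y =>
    if (st y.1).sits = ∅ then .move (y.2 (Classical.arbitrary Agt))
    else .resp fun d => if d ∈ (st y.1).devs then some (y.2 d) else none
  -- The final query is made at the empty history, and its answer is ignored by the output.
  refine effective_of_fold (S := S) (X := Agt × Option Y) (R := R)
    (xs := fun H => agents.flatMap (block H)) s₀
    (q := Prod.fst) (step := step) (out := fun z => eveOut (z.1.1.head?, z.1.2.2))
    ?_ Primrec.fst ?_ ?_ ?_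
  · refine Primrec.list_flatMap (Primrec.const agents) ?_
    refine Primrec.list_append.comp (Primrec.list_map (Primrec.list_reverse.comp Primrec.fst) ?_) ?_
    · exact Primrec.pair (Primrec.snd.comp Primrec.fst) (Primrec.option_some.comp Primrec.snd)
    · exact Primrec.list_cons.comp (Primrec.pair Primrec.snd (Primrec.const none))
        (Primrec.const [])
  · have hd : Primrec fun z : (S × R) × (Agt × Option Y) => z.2.1 :=
      Primrec.fst.comp Primrec.snd
    have hres : Primrec fun z : (S × R) × (Agt × Option Y) => z.1.1.2 :=
      Primrec.snd.comp (Primrec.fst.comp Primrec.fst)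
    have hr : Primrec fun z : (S × R) × (Agt × Option Y) => z.1.2 :=
      Primrec.snd.comp Primrec.fst
    refine (Primrec.option_casesOn (o := fun z : (S × R) × (Agt × Option Y) => z.2.2)
      (f := fun z => (([], Function.update z.1.1.2 z.2.1 fun a => (z.1.2 a).1) : S))
      (g := fun z y =>
        (((A.roundMove y z.2.1, fun a => (z.1.2 a).2, y.2.vtx) :: z.1.1.1, z.1.1.2) : S))
      (Primrec.snd.comp Primrec.snd) ?_ ?_).of_eq ?_
    · refine Primrec.pair (Primrec.const []) ?_
      exact (Primrec.dom_finite fun y : ((Agt → Agt → Act) × Agt) × (Agt → Act) =>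
        Function.update y.1.1 y.1.2 y.2).comp
          ((hres.pair hd).pair ((primrec_tupleCoding_map_finite Primrec.fst).comp hr))
    · refine Primrec.pair (Primrec.list_cons.comp (Primrec.pair ?_ (Primrec.pair ?_ ?_)) ?_)
        (hres.comp Primrec.fst)
      · exact (Primrec.dom_finite fun y : Y × Agt => A.roundMove y.1 y.2).comp
          (Primrec.snd.pair (hd.comp Primrec.fst))
      · exact (primrec_tupleCoding_map Primrec.snd).comp (hr.comp Primrec.fst)
      · exact (Primrec.dom_finite fun y : Y => y.2.vtx).comp Primrec.snd
      · exact Primrec.fst.comp (Primrec.fst.comp (Primrec.fst.comp Primrec.fst))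
    · rintro ⟨z, d, _ | y⟩ <;> rfl
  · exact (Primrec.dom_finite eveOut).comp (Primrec.pair
      (Primrec.list_head?.comp (Primrec.fst.comp Primrec.fst))
      (Primrec.snd.comp (Primrec.snd.comp Primrec.fst)))
  · intro σ H
    have hrounds : ∀ d res (H : EpiHist V Act Agt), oracleFold Prod.fst step σ (([], res) : S)
        (H.reverse.map fun x => (d, some x)) = (A.simulate (fun a h => σ h a) d H, res) := by
      intro d res H
      induction H with
      | nil => rfl
      | cons x H ih =>
        simp only [oracleFold] at ih
        simp only [oracleFold, List.reverse_cons, List.map_append, List.foldl_append, ih,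
          List.map_cons, List.map_nil, List.foldl_cons, List.foldl_nil, step, Option.elim_some,
          simulate]
    have hblock : ∀ d res, oracleFold Prod.fst step σ (([], res) : S) (block H d) =
        ([], Function.update res d fun a => (σ (A.simulate (fun a h => σ h a) d H) a).1) := by
      intro d res
      have := hrounds d res H
      simp only [oracleFold] at this
      simp only [oracleFold, block, List.foldl_append]
      rw [this]
      rfl
    have hall : ∀ (ds : List Agt) res, oracleFold Prod.fst step σ (([], res) : S)
        (ds.flatMap (block H)) = ([], fun d => if d ∈ ds then
          fun a => (σ (A.simulate (fun a h => σ h a) d H) a).1 else res d) := by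
      intro ds
      induction ds with
      | nil => intro res; simp [oracleFold]
      | cons d ds ih =>
        intro res
        have h1 := hblock d res
        have h2 := ih (Function.update res d fun a =>
          (σ (A.simulate (fun a h => σ h a) d H) a).1)
        simp only [oracleFold] at h1 h2
        simp only [oracleFold, List.flatMap_cons, List.foldl_append, h1, h2, Prod.mk.injEq,
          true_and]
        funext e
        by_cases he : e ∈ ds
        · simp [he]
        · by_cases hed : e = d
          · subst hed
            simp [he]
          · simp [he, hed]
    have hmem : ∀ d, d ∈ agents := fun d => by
      simp only [agents, List.mem_ofFn]
      exact ⟨Finite.equivFin Agt d, by simp⟩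
    rw [hall]
    simp only [hmem, if_true, eveOut, st, toEve, last_eq_elim_head?]

end ToEve

end Arena

end CommGame

theorem theorem2 {V Act Agt : Type*} [Finite V] [Finite Act] [Finite Agt] [DecidableEq Agt]
    [Nonempty Agt] (A : CommGame.Arena V Act Agt) (G : Digraph Agt) :
    (∀ (payoff : Agt → (ℕ → V) → EReal) (p : Agt → EReal),
      (∃ σ : CommGame.Profile V Act Agt,
        (CommGame.ConcurrentGame.mk A payoff).IsNash G σ ∧
          (CommGame.ConcurrentGame.mk A payoff).HasPayoff σ p) ↔
      ∃ ζ : CommGame.EpiHist V Act Agt → CommGame.EveAction Act Agt,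
        (CommGame.ConcurrentGame.mk A payoff).EveWins G ζ p) ∧
    ∃ (Ω : (CommGame.EpiHist V Act Agt → CommGame.EveAction Act Agt) →
          CommGame.Profile V Act Agt)
      (Υ : CommGame.Profile V Act Agt →
          CommGame.EpiHist V Act Agt → CommGame.EveAction Act Agt),
      CommGame.EffectiveToProfile Ω ∧ CommGame.EffectiveToEve Υ ∧
      ∀ (payoff : Agt → (ℕ → V) → EReal) (p : Agt → EReal),
        (∀ ζ, (CommGame.ConcurrentGame.mk A payoff).EveWins G ζ p →
          (CommGame.ConcurrentGame.mk A payoff).IsNash G (Ω ζ) ∧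
            (CommGame.ConcurrentGame.mk A payoff).HasPayoff (Ω ζ) p) ∧
        (∀ σ, (CommGame.ConcurrentGame.mk A payoff).IsNash G σ →
          (CommGame.ConcurrentGame.mk A payoff).HasPayoff σ p →
          (CommGame.ConcurrentGame.mk A payoff).EveWins G (Υ σ) p) :=
  ⟨fun _ _ => ⟨fun ⟨_, hN, hp⟩ => ⟨_, CommGame.Arena.eveWins_toEve hN hp⟩,
    fun ⟨_, hw⟩ => ⟨_, CommGame.Arena.isNash_toProfile hw⟩⟩,
    A.toProfile G, A.toEve G, CommGame.Arena.effectiveToProfile_toProfile,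
    CommGame.Arena.effectiveToEve_toEve, fun _ _ =>
      ⟨fun _ => CommGame.Arena.isNash_toProfile, fun _ => CommGame.Arena.eveWins_toEve⟩⟩
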